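/- Let $a>0$, let $k\ge 1$ and $k_b\ge 0$ be integers, and let $\lambda>0$. Let $r\ge 0$, $p\ge 1$ be integers and let $a_{-r},\dots,a_p$ be real numbers with $a_{-r}\,a_p\neq 0$ that satisfy $$\sum_{\ell=-r}^p \ell^m a_\ell=(-\lambda a)^m \quad (m=0,\dots,k),\qquad \sup_{\theta\in[0,2\pi]}\Big|\sum_{\ell=-r}^p a_\ell\, e^{i\ell\theta}\Big|\le 1 .$$ Put $k_0:=\min(k,k_b)$ and $(D_-v)_j:=v_j-v_{j-1}$. Then there exists a constant $C>0$, depending only on $a,\lambda,k,k_b,r,p$ and the coefficients $a_\ell$, such that the following holds for all real $T>0$, all integers $J\ge 1$, all real $L\ge 1$ such that $\Delta x:=L/J$ and $\Delta t:=\lambda\,\Delta x$ satisfy $\Delta t\le 1$, and all real-valued $u_0\in H^{k+1}((-\infty,L))$. Write $x_j:=j\,\Delta x$ for $j\in\mathbb Z$ and $t^n:=n\,\Delta t$ for $n\in\mathbb N$, and let $(u_j^n)$ be the solution of $$\begin{cases} u_j^0=\dfrac1{\Delta x}\displaystyle\int_{x_{j-1}}^{x_j}u_0(y)\,dy, & j\le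 J,\\[2mm] (D_-^{k_b}u^n)_{J+\ell}=0, & 0\le n\le T/\Delta t-1,\ \ell=1,\dots,p,\\[1mm] u_j^{n+1}=\displaystyle\sum_{\ell=-r}^p a_\ell\,u_{j+\ell}^n, & 0\le n\le T/\Delta t-1,\ j\le J.\end{cases}$$ Then $$\sup_{0\le n\le T/\Delta t}\Big(\sum_{j\le J}\Delta x\Big(u_j^n-\frac1{\Delta x}\int_{x_{j-1}}^{x_j}u_0(y-at^n)\,dy\Big)^2\Big)^{1/2}\le C\,(\sqrt T+T)\,\Delta x^{k_0}\,\|u_0\|_{H^{k_0+1}((-\infty,L))},$$ and in particular $$\sup_{0\le n\le T/\Delta t}\ \sup_{j\le J}\Big|u_j^n-\frac1{\Delta x}\int_{x_{j-1}}^{x_j}u_0(y-at^n)\,dy\Big|\le C\,(\sqrt T+T)\,\Delta x^{k_0-1/2}\,\|u_0\|_{H^{k_0+1}((-\infty,L))}.$$ Here $\|u\|_{H^m}^2=\sum_{i=0}^m\|u^{(i)}\|_{L^2}^2$ with weak derivatives $u^{(i)}$. -/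

import Mathlib

open MeasureTheory

namespace NeumannScheme

noncomputable section

/-! ### Sobolev spaces on an open subset of the line, through weak derivatives -/

/-- `v` is a weak derivative of order `i` of `u` on the open set `U`: both are locally integrable
on `U` and the integration by parts formula holds against every smooth test function whose support
is a compact subset of `U`. -/
def IsWeakDeriv (U : Set ℝ) (i : ℕ) (u v : ℝ → ℝ) : Prop :=
  LocallyIntegrableOn u U ∧ LocallyIntegrableOn v U ∧
    ∀ φ : ℝ → ℝ, ContDiff ℝ (⊤ : ℕ∞) φ → HasCompactSupport φ → tsupport φ ⊆ U →
      ∫ x in U, u x * iteratedDeriv i φ x = (-1 : ℝ) ^ i * ∫ x in U, v x * φ x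

/-- Weak derivatives on an open set are unique up to equality almost everywhere. -/
theorem IsWeakDeriv.ae_eq {U : Set ℝ} (hU : IsOpen U) {i : ℕ} {u v w : ℝ → ℝ}
    (hv : IsWeakDeriv U i u v) (hw : IsWeakDeriv U i u w) :
    v =ᵐ[volume.restrict U] w := by
  have key : ∀ᵐ x, x ∈ U → (v - w) x = 0 := by
    refine hU.ae_eq_zero_of_integral_contDiff_smul_eq_zero (hv.2.1.sub hw.2.1) ?_
    intro φ hφ hc hs
    have hout : ∀ x, x ∉ U → φ x = 0 := fun x hx =>
      image_eq_zero_of_notMem_tsupport (fun h => hx (hs h))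
    have hint : ∀ f : ℝ → ℝ, LocallyIntegrableOn f U →
        IntegrableOn (fun x => f x * φ x) U := by
      intro f hf
      have h1 : IntegrableOn (fun x => f x * φ x) (tsupport φ) :=
        (hf.integrableOn_compact_subset hs hc).mul_continuousOn
          hφ.continuous.continuousOn hc
      have h2 : Integrable (fun x => f x * φ x) :=
        (integrableOn_iff_integrable_of_support_subset (fun x hx => subset_tsupport φ
          (fun h => hx (by simp [h])))).1 h1
      exact h2.integrableOn
    have e : ∫ x in U, v x * φ x = ∫ x in U, w x * φ x := by
      have h := (hv.2.2 φ hφ hc hs).symm.trans (hw.2.2 φ hφ hc hs)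
      exact mul_left_cancel₀ (pow_ne_zero i (by norm_num)) h
    have h3 : ∫ x, φ x • (v - w) x = ∫ x in U, φ x • (v - w) x :=
      (setIntegral_eq_integral_of_forall_compl_eq_zero (fun x hx => by simp [hout x hx])).symm
    rw [h3]
    have h4 : ∀ x, φ x • (v - w) x = v x * φ x - w x * φ x := by
      intro x
      simp only [Pi.sub_apply, smul_eq_mul]
      ring
    simp only [h4]
    rw [integral_sub (hint v hv.2.1) (hint w hw.2.1), e, sub_self]
  filter_upwards [ae_restrict_of_ae key, ae_restrict_mem hU.measurableSet] with x hx hxU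
  have := hx hxU
  simp only [Pi.sub_apply] at this
  linarith

open Classical in
/-- The weak derivative of order `i` of `u` on `U` (some representative; `0` if there is none). -/
def weakDeriv (U : Set ℝ) (i : ℕ) (u : ℝ → ℝ) : ℝ → ℝ :=
  if h : ∃ v, IsWeakDeriv U i u v then h.choose else 0

/-- The restriction of `u` to `U` belongs to `H^m(U)`: it is square integrable and has square
integrable weak derivatives of all orders `i ≤ m`. -/
def MemH (m : ℕ) (U : Set ℝ) (u : ℝ → ℝ) : Prop :=
  MemLp u 2 (volume.restrict U) ∧
    ∀ i ≤ m, ∃ v, IsWeakDeriv U i u v ∧ MemLp v 2 (volume.restrict U)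

/-- The norm of `H^m(U)`, `(∑_{i ≤ m} ‖u^{(i)}‖²_{L²(U)})^{1/2}`. -/
def normH (m : ℕ) (U : Set ℝ) (u : ℝ → ℝ) : ℝ :=
  Real.sqrt (∑ i ∈ Finset.range (m + 1), ∫ x in U, (weakDeriv U i u x) ^ 2)

/-! ### The scheme -/

/-- The linear operator `(v_j) ↦ (∑_{ℓ=-r}^p α_ℓ v_{j+ℓ})`. -/
def stencil (r p : ℕ) (α : ℤ → ℝ) (v : ℤ → ℝ) (j : ℤ) : ℝ :=
  ∑ l ∈ Finset.Icc (-(r : ℤ)) (p : ℤ), α l * v (j + l)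

/-- Normalization, consistency of order `k` with the transport equation of velocity `a` at the
mesh ratio `lam = Δt / Δx`, and `ℓ²`-stability, of the coefficients `α_{-r}, …, α_p`. -/
structure SchemeAssumption (a lam : ℝ) (k r p : ℕ) (α : ℤ → ℝ) : Prop where
  normalized : α (-(r : ℤ)) * α (p : ℤ) ≠ 0
  consistent : ∀ m ≤ k,
    ∑ l ∈ Finset.Icc (-(r : ℤ)) (p : ℤ), (l : ℝ) ^ m * α l = (-(lam * a)) ^ m
  stable : ∀ θ ∈ Set.Icc (0 : ℝ) (2 * Real.pi),
    ‖∑ l ∈ Finset.Icc (-(r : ℤ)) (p : ℤ),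
      (α l : ℂ) * Complex.exp (Complex.I * (l : ℂ) * (θ : ℂ))‖ ≤ 1

/-- The backward difference `(D_- v)_j = v_j - v_{j-1}`. -/
def Dminus (v : ℤ → ℝ) (j : ℤ) : ℝ := v j - v (j - 1)

/-- The average of `f` over the cell `(x_{j-1}, x_j)`, where `x_j = j Δx`. -/
def cellAverage (dx : ℝ) (f : ℝ → ℝ) (j : ℤ) : ℝ :=
  (1 / dx) * ∫ y in (((j : ℝ) - 1) * dx)..((j : ℝ) * dx), f y

/-- `u n j = u_j^n` solves, up to time `T`, the scheme on the half-line of cells `j ≤ J`, with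
initial data the cell averages of `u₀` and with the homogeneous Neumann condition of order `kb`
in the `p` ghost cells `j = J + 1, …, J + p`.  (Values `u n j` with `j > J + p` play no role.) -/
structure IsSolution (r p : ℕ) (α : ℤ → ℝ) (kb : ℕ) (J : ℕ) (dx dt T : ℝ) (u₀ : ℝ → ℝ)
    (u : ℕ → ℤ → ℝ) : Prop where
  init : ∀ j : ℤ, j ≤ (J : ℤ) → u 0 j = cellAverage dx u₀ j
  boundary : ∀ n : ℕ, (n : ℝ) ≤ T / dt - 1 → ∀ l ∈ Finset.Icc 1 p,
    (Dminus^[kb] (u n)) ((J : ℤ) + (l : ℤ)) = 0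
  interior : ∀ n : ℕ, (n : ℝ) ≤ T / dt - 1 → ∀ j : ℤ, j ≤ (J : ℤ) →
    u (n + 1) j = stencil r p α (u n) j

/-- The error `u_j^n - (1/Δx) ∫_{x_{j-1}}^{x_j} u₀(y - a t^n) dy` with `t^n = n Δt`. -/
def schemeError (a dx dt : ℝ) (u₀ : ℝ → ℝ) (u : ℕ → ℤ → ℝ) (n : ℕ) (j : ℤ) : ℝ :=
  u n j - cellAverage dx (fun y => u₀ (y - a * ((n : ℝ) * dt))) j

end

end NeumannScheme

open NeumannScheme

namespace NeumannScheme

/-! The proof is stability plus consistency, with stability obtained by an energy method in which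
the boundary data are paid for by dissipation at the boundary.

Interior stability is Plancherel: the symbol has modulus at most one on the unit circle, so the
stencil contracts `ℓ²(ℤ)`. On the half-line this is applied to an extension `w` of the solution `v`
beyond the ghost cells. The contraction also counts the mass that the stencil sends to cells `j >
0`, and the choice of `w` decides what this yields. Extension by zero (`exists_energy_dirichlet`)
gives control of the trace on `-r < j ≤ p`, since `α (-r) ≠ 0` lets the rightmost values be solved
for one after the other. Extension by a multiple of a slowly varying cutoff
(`exists_energy_neumann`) gives an outgoing flux close to `lam * a > 0` times the square of a
boundary value, so the trace is controlled by that of `Dminus v` alone.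

The difference operator commutes with the stencil, so if `e` solves the problem with Neumann order
`kb + 1`, then `Dminus e` solves it with order `kb`. Induction on `kb`, from the Dirichlet case,
gives `exists_stability`: after `N` steps the energy is at most a constant times `N² Φ + N Γ`, where
`Φ` bounds the energy of the forcing and `Γ` the squared boundary data at each step.

For consistency, `u₀` is extended past `L` by extending its top derivative by zero and integrating
back (`exists_extension`). With `q = min k kb`, a Taylor expansion of order `q` gives `Φ` of order
`dx^(2q+1)`, and `kb` backward differences of the exact solution give `Γ` of order `dx^(2q)`.
Multiplied by `dx`, with `N dx ≤ T / lam`, the energy bound is of order `(T² + T) dx^(2q)`; its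
square root is the claim. -/

/-! ### Plancherel and the `ℓ²` contraction -/

open Polynomial in
/-- The symbol of the stencil, multiplied by `X ^ r` to make it a polynomial. -/
noncomputable def symbolPoly (r p : ℕ) (α : ℤ → ℝ) : ℂ[X] :=
  ∑ l ∈ Finset.Icc (-(r : ℤ)) (p : ℤ), C (α l : ℂ) * X ^ (l + r).toNat

theorem norm_eval_symbolPoly {r p : ℕ} {α : ℤ → ℝ} (θ : ℝ) :
    ‖(symbolPoly r p α).eval (circleMap 0 1 θ)‖ =
      ‖∑ l ∈ Finset.Icc (-(r : ℤ)) (p : ℤ),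
        (α l : ℂ) * Complex.exp (Complex.I * (l : ℂ) * (θ : ℂ))‖ := by
  have h : (symbolPoly r p α).eval (circleMap 0 1 θ) =
      Complex.exp (((r * θ : ℝ) : ℂ) * Complex.I) * ∑ l ∈ Finset.Icc (-(r : ℤ)) (p : ℤ),
        (α l : ℂ) * Complex.exp (Complex.I * (l : ℂ) * (θ : ℂ)) := by
    rw [symbolPoly, Polynomial.eval_finsetSum, Finset.mul_sum]
    refine Finset.sum_congr rfl fun l hl => ?_
    have hl' : (((l + r).toNat : ℕ) : ℂ) = (l : ℂ) + r := by
      have : (((l + r).toNat : ℕ) : ℤ) = l + r :=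
        Int.toNat_of_nonneg (by have := (Finset.mem_Icc.1 hl).1; linarith)
      exact_mod_cast this
    rw [Polynomial.eval_mul, Polynomial.eval_C, Polynomial.eval_pow, Polynomial.eval_X,
      circleMap, zero_add, Complex.ofReal_one, one_mul, ← Complex.exp_nat_mul, hl',
      mul_left_comm (Complex.exp _), ← Complex.exp_add]
    congr 2
    push_cast
    ring
  rw [h, norm_mul, Complex.norm_exp_ofReal_mul_I, one_mul]

theorem sum_sq_coeff_eq_circleAverage (P : Polynomial ℂ) {n : ℕ} (hn : P.natDegree < n) :
    ∑ i ∈ Finset.range n, ‖P.coeff i‖ ^ 2 =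
      Real.circleAverage (fun z => ‖P.eval z‖ ^ 2) 0 1 := by
  rw [← Polynomial.sum_sq_norm_coeff_eq_circleAverage]
  symm
  refine Finset.sum_subset (fun i hi => ?_) fun i _ hi => ?_
  · exact Finset.mem_range.2 ((Polynomial.le_natDegree_of_mem_supp i hi).trans_lt hn)
  · simp [Polynomial.notMem_support_iff.1 hi]

/-- An `ℓ²`-stable stencil is a contraction for sequences vanishing far to the right, in the sense
of partial sums. -/
theorem sum_sq_stencil_le {a lam : ℝ} {k r p : ℕ} {α : ℤ → ℝ} (hα : SchemeAssumption a lam k r p α)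
    {v : ℤ → ℝ} {M : ℤ} (hv : ∀ j, M < j → v j = 0) (n : ℕ) :
    ∑ i ∈ Finset.range n, (stencil r p α v (M + r - i)) ^ 2 ≤
      ∑ i ∈ Finset.range n, (v (M - i)) ^ 2 := by
  set V : Polynomial ℂ := ∑ i ∈ Finset.range n, Polynomial.C (v (M - i) : ℂ) * Polynomial.X ^ i
    with hV
  have hVc : ∀ i, V.coeff i = if i < n then (v (M - i) : ℂ) else 0 := by
    intro i
    simp [hV, Polynomial.finsetSum_coeff]
  -- The polynomial lists the values from right to left starting at `M`, so the coefficient of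
  -- degree `i` of the product involves only `v` at cells `≥ M - i`. Truncating `v` to `n` values is
  -- therefore invisible for `i < n`.
  have hQc : ∀ i < n, (symbolPoly r p α * V).coeff i = (stencil r p α v (M + r - i) : ℂ) := by
    intro i hi
    rw [symbolPoly, Finset.sum_mul, Polynomial.finsetSum_coeff, stencil, Complex.ofReal_sum]
    refine Finset.sum_congr rfl fun l hl => ?_
    have hl0 : -(r : ℤ) ≤ l := (Finset.mem_Icc.1 hl).1
    rw [mul_assoc, Polynomial.coeff_C_mul, Polynomial.coeff_X_pow_mul', Complex.ofReal_mul]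
    congr 1
    split_ifs with h
    · rw [hVc, if_pos (by omega)]
      congr 2
      omega
    · rw [hv _ (by omega), Complex.ofReal_zero]
  set Q := symbolPoly r p α * V with hQ
  calc ∑ i ∈ Finset.range n, (stencil r p α v (M + r - i)) ^ 2
      = ∑ i ∈ Finset.range n, ‖Q.coeff i‖ ^ 2 := by
        refine Finset.sum_congr rfl fun i hi => ?_
        rw [hQc i (Finset.mem_range.1 hi), Complex.norm_real, Real.norm_eq_abs, sq_abs]
    _ ≤ ∑ i ∈ Finset.range (n + (Q.natDegree + 1)), ‖Q.coeff i‖ ^ 2 :=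
        Finset.sum_le_sum_of_subset_of_nonneg (Finset.range_mono (by omega))
          fun _ _ _ => sq_nonneg _
    _ = Real.circleAverage (fun z => ‖Q.eval z‖ ^ 2) 0 1 :=
        sum_sq_coeff_eq_circleAverage Q (by omega)
    _ ≤ Real.circleAverage (fun z => ‖V.eval z‖ ^ 2) 0 1 := by
        have hc : ∀ P : Polynomial ℂ, Continuous fun θ => ‖P.eval (circleMap 0 1 θ)‖ ^ 2 :=
          fun P => ((P.continuous.comp (continuous_circleMap 0 1)).norm).pow 2
        rw [Real.circleAverage_def, Real.circleAverage_def, smul_eq_mul, smul_eq_mul]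
        refine mul_le_mul_of_nonneg_left ?_ (by positivity)
        refine intervalIntegral.integral_mono_on Real.two_pi_pos.le
          ((hc Q).intervalIntegrable _ _) ((hc V).intervalIntegrable _ _) fun θ hθ => ?_
        have h1 := hα.stable θ hθ
        rw [← norm_eval_symbolPoly] at h1
        rw [hQ, Polynomial.eval_mul, norm_mul]
        exact pow_le_pow_left₀ (by positivity) (mul_le_of_le_one_left (norm_nonneg _) h1) 2
    _ = ∑ i ∈ Finset.range (n + (V.natDegree + 1)), ‖V.coeff i‖ ^ 2 :=
        (sum_sq_coeff_eq_circleAverage V (by omega)).symm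
    _ = ∑ i ∈ Finset.range n, (v (M - i)) ^ 2 := by
        rw [Finset.sum_range_add, Finset.sum_congr rfl (g := fun i : ℕ => (v (M - i)) ^ 2),
          Finset.sum_eq_zero (s := Finset.range (V.natDegree + 1)), add_zero]
        · intro i _
          simp [hVc]
        · intro i hi
          simp [hVc, Finset.mem_range.1 hi]

/-! ### Energy balance on the half-line -/

/-- The squared `ℓ²` norm over the cells `j ≤ 0`. -/
noncomputable def energy (v : ℤ → ℝ) : ℝ := ∑' i : ℕ, (v (-(i : ℤ))) ^ 2

/-- Square summability over the cells `j ≤ 0`. -/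
def FiniteEnergy (v : ℤ → ℝ) : Prop := Summable fun i : ℕ => (v (-(i : ℤ))) ^ 2

theorem energy_nonneg (v : ℤ → ℝ) : 0 ≤ energy v := tsum_nonneg fun _ => sq_nonneg _

theorem energy_congr {v w : ℤ → ℝ} (h : ∀ j ≤ 0, v j = w j) : energy v = energy w :=
  tsum_congr fun i => by rw [h _ (by omega)]

theorem FiniteEnergy.congr {v w : ℤ → ℝ} (hv : FiniteEnergy v) (h : ∀ j ≤ 0, v j = w j) :
    FiniteEnergy w :=
  Summable.congr hv fun i => by rw [h _ (by omega)]

theorem stencil_congr {r p : ℕ} {α : ℤ → ℝ} {v w : ℤ → ℝ} {j : ℤ}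
    (h : ∀ i, j - r ≤ i → i ≤ j + p → v i = w i) :
    stencil r p α v j = stencil r p α w j := by
  refine Finset.sum_congr rfl fun l hl => ?_
  rw [Finset.mem_Icc] at hl
  rw [h _ (by linarith) (by linarith)]

theorem sum_range_split_half_line (f : ℤ → ℝ) (N n : ℕ) :
    ∑ i ∈ Finset.range (N + n), f ((N : ℤ) - i) =
      ∑ i ∈ Finset.range N, f ((i : ℤ) + 1) + ∑ i ∈ Finset.range n, f (-(i : ℤ)) := by
  rw [Finset.sum_range_add, ← Finset.sum_range_reflect (fun i : ℕ => f ((i : ℤ) + 1))]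
  congr 1
  · refine Finset.sum_congr rfl fun i hi => ?_
    have := Finset.mem_range.1 hi
    congr 1
    omega
  · refine Finset.sum_congr rfl fun i hi => ?_
    congr 1
    push_cast
    ring

/-- Energy inequality on the half-line: `w` is any extension of `v` that vanishes far to the
right. -/
theorem energy_stencil_le {a lam : ℝ} {k r p : ℕ} {α : ℤ → ℝ} (hα : SchemeAssumption a lam k r p α)
    {v w : ℤ → ℝ} (hfin : FiniteEnergy v) (hvw : ∀ j : ℤ, j ≤ p → w j = v j) {N : ℕ}
    (hw : ∀ j : ℤ, (N : ℤ) - r < j → w j = 0) :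
    FiniteEnergy (stencil r p α v) ∧
      energy (stencil r p α v) + ∑ i ∈ Finset.range N, (stencil r p α w ((i : ℤ) + 1)) ^ 2 ≤
        energy v + ∑ i ∈ Finset.range N, (w ((i : ℤ) + 1)) ^ 2 := by
  have hE : ∀ n, ∑ i ∈ Finset.range n, (stencil r p α v (-(i : ℤ))) ^ 2 +
      ∑ i ∈ Finset.range N, (stencil r p α w ((i : ℤ) + 1)) ^ 2 ≤
        energy v + ∑ i ∈ Finset.range N, (w ((i : ℤ) + 1)) ^ 2 := by
    intro n
    have h1 := sum_sq_stencil_le hα hw (N + n)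
    -- The contraction is used with `M = N - r`; renumbering from `N` adds `r` nonnegative terms at
    -- the right end.
    have h2 : ∑ i ∈ Finset.range (N + n), (w ((N : ℤ) - r - i)) ^ 2 ≤
        ∑ i ∈ Finset.range (N + (n + r)), (w ((N : ℤ) - i)) ^ 2 := by
      rw [show N + (n + r) = r + (N + n) by ring,
        Finset.sum_range_add _ r (N + n)]
      have : ∀ i : ℕ, w ((N : ℤ) - r - i) = w ((N : ℤ) - ((r + i : ℕ) : ℤ)) := fun i => by
        congr 1; push_cast; ring
      simp only [this]
      exact le_add_of_nonneg_left (Finset.sum_nonneg fun i _ => sq_nonneg (w ((N : ℤ) - i)))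
    simp only [sub_add_cancel] at h1
    rw [sum_range_split_half_line (fun j => (w j) ^ 2)] at h2
    rw [sum_range_split_half_line (fun j => (stencil r p α w j) ^ 2)] at h1
    have h3 : ∑ i ∈ Finset.range (n + r), (w (-(i : ℤ))) ^ 2 ≤ energy v := by
      have : ∀ i : ℕ, w (-(i : ℤ)) = v (-(i : ℤ)) := fun i => hvw (-(i : ℤ)) (by omega)
      simp only [this]
      exact hfin.sum_le_tsum _ fun _ _ => sq_nonneg _
    have h4' : ∀ i : ℕ, stencil r p α v (-(i : ℤ)) = stencil r p α w (-(i : ℤ)) := fun i =>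
      stencil_congr fun j _ hj => (hvw j (by omega)).symm
    have h4 : ∑ i ∈ Finset.range n, (stencil r p α v (-(i : ℤ))) ^ 2 =
        ∑ i ∈ Finset.range n, (stencil r p α w (-(i : ℤ))) ^ 2 :=
      Finset.sum_congr rfl fun i _ => by rw [h4']
    linarith
  have hs : FiniteEnergy (stencil r p α v) :=
    summable_of_sum_range_le (fun _ => sq_nonneg _) fun n => le_sub_iff_add_le.2 (hE n)
  refine ⟨hs, ?_⟩
  rw [← le_sub_iff_add_le]
  exact Real.tsum_le_of_sum_range_le (fun _ => sq_nonneg _) fun n => le_sub_iff_add_le.2 (hE n)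

/-! ### Boundary dissipation for Dirichlet data -/

/-- The rightmost values of a sequence are controlled by those of its image by the stencil. -/
theorem exists_abs_le_of_stencil {a lam : ℝ} {k r p : ℕ} {α : ℤ → ℝ}
    (hα : SchemeAssumption a lam k r p α) (i : ℕ) :
    ∃ C : ℝ, 0 ≤ C ∧ ∀ (v : ℤ → ℝ) (M : ℤ), (∀ j, M < j → v j = 0) → ∀ B : ℝ,
      (∀ i' : ℕ, i' ≤ i → |stencil r p α v (M + r - i')| ≤ B) → |v (M - i)| ≤ C * B := by
  induction i using Nat.strong_induction_on with
  | _ i ih =>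
    choose! C hC0 hC using ih
    set D := ∑ m ∈ Finset.range i, C m with hD
    have hD0 : 0 ≤ D := Finset.sum_nonneg fun m hm => hC0 m (Finset.mem_range.1 hm)
    have hr : α (-(r : ℤ)) ≠ 0 := left_ne_zero_of_mul hα.normalized
    set S := ∑ l ∈ Finset.Ioc (-(r : ℤ)) (p : ℤ), |α l| with hS
    have hS0 : 0 ≤ S := Finset.sum_nonneg fun _ _ => abs_nonneg _
    refine ⟨(1 + S * D) / |α (-(r : ℤ))|, by positivity, fun v M hv B hB => ?_⟩
    have hB0 : 0 ≤ B := (abs_nonneg _).trans (hB i le_rfl)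
    have htop : ∀ j, M - i < j → |v j| ≤ D * B := by
      intro j hj
      rcases lt_or_ge M j with h | h
      · rw [hv j h, abs_zero]
        positivity
      · obtain ⟨m, hm⟩ : ∃ m : ℕ, j = M - m := ⟨(M - j).toNat, by omega⟩
        have hmi : m < i := by omega
        rw [hm]
        refine (hC m hmi v M hv B fun i' hi' => hB i' (by omega)).trans ?_
        exact mul_le_mul_of_nonneg_right (Finset.single_le_sum
          (fun m hm => hC0 m (Finset.mem_range.1 hm)) (Finset.mem_range.2 hmi)) hB0
    -- The leftmost coefficient multiplies `v (M - i)`, and every other term lies further right,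
    -- where the induction already gives a bound: a triangular system with diagonal `α (-r) ≠ 0`.
    have hsplit : stencil r p α v (M + r - i) = α (-(r : ℤ)) * v (M - i) +
        ∑ l ∈ Finset.Ioc (-(r : ℤ)) (p : ℤ), α l * v (M + r - i + l) := by
      rw [stencil, ← Finset.Ioc_insert_left (by omega), Finset.sum_insert Finset.left_notMem_Ioc]
      congr 3
      ring
    have hsum : |∑ l ∈ Finset.Ioc (-(r : ℤ)) (p : ℤ), α l * v (M + r - i + l)| ≤ S * (D * B) := by
      refine (Finset.abs_sum_le_sum_abs _ _).trans ?_
      rw [hS, Finset.sum_mul]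
      refine Finset.sum_le_sum fun l hl => ?_
      rw [abs_mul]
      rw [Finset.mem_Ioc] at hl
      exact mul_le_mul_of_nonneg_left (htop _ (by linarith)) (abs_nonneg _)
    rw [div_mul_eq_mul_div, le_div_iff₀ (abs_pos.2 hr), mul_comm, ← abs_mul,
      show α (-(r : ℤ)) * v (M - i) = stencil r p α v (M + r - i) -
        ∑ l ∈ Finset.Ioc (-(r : ℤ)) (p : ℤ), α l * v (M + r - i + l) by rw [hsplit]; ring]
    refine (abs_sub _ _).trans ?_
    have := hB i le_rfl
    linarith

/-- The sum of the squared values next to the boundary, on the cells `-r < j ≤ p`. -/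
noncomputable def boundaryTrace (r p : ℕ) (v : ℤ → ℝ) : ℝ :=
  ∑ j ∈ Finset.Ioc (-(r : ℤ)) (p : ℤ), (v j) ^ 2

theorem boundaryTrace_nonneg (r p : ℕ) (v : ℤ → ℝ) : 0 ≤ boundaryTrace r p v :=
  Finset.sum_nonneg fun _ _ => sq_nonneg _

theorem boundaryTrace_le {r p : ℕ} {v : ℤ → ℝ} {B : ℝ}
    (h : ∀ j : ℤ, -(r : ℤ) < j → j ≤ p → (v j) ^ 2 ≤ B) :
    boundaryTrace r p v ≤ ((p : ℝ) + r) * B := by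
  have h1 := Finset.sum_le_card_nsmul (Finset.Ioc (-(r : ℤ)) (p : ℤ)) (fun j => (v j) ^ 2) B
    fun j hj => h j (Finset.mem_Ioc.1 hj).1 (Finset.mem_Ioc.1 hj).2
  rw [Int.card_Ioc, nsmul_eq_mul, sub_neg_eq_add] at h1
  have h2 : ((((p : ℤ) + r).toNat : ℕ) : ℝ) = (p : ℝ) + r := by
    rw [← Nat.cast_add, Int.toNat_natCast]
    push_cast
    ring
  rwa [h2] at h1

theorem abs_stencil_le {r p : ℕ} {α : ℤ → ℝ} {v : ℤ → ℝ} {j : ℤ} {B : ℝ}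
    (h : ∀ i, j - r ≤ i → i ≤ j + p → |v i| ≤ B) :
    |stencil r p α v j| ≤ (∑ l ∈ Finset.Icc (-(r : ℤ)) (p : ℤ), |α l|) * B := by
  refine (Finset.abs_sum_le_sum_abs _ _).trans ?_
  rw [Finset.sum_mul]
  refine Finset.sum_le_sum fun l hl => ?_
  rw [Finset.mem_Icc] at hl
  rw [abs_mul]
  exact mul_le_mul_of_nonneg_left (h _ (by linarith) (by linarith)) (abs_nonneg _)

/-- Energy estimate with dissipation at the boundary for Dirichlet data. -/
theorem exists_energy_dirichlet {a lam : ℝ} {k r p : ℕ} {α : ℤ → ℝ}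
    (hα : SchemeAssumption a lam k r p α) :
    ∃ c C : ℝ, 0 < c ∧ 0 ≤ C ∧ ∀ v, FiniteEnergy v →
      energy (stencil r p α v) + c * boundaryTrace r p v ≤
        energy v + C * ∑ i ∈ Finset.range p, (v ((i : ℤ) + 1)) ^ 2 := by
  choose D hD0 hD using exists_abs_le_of_stencil hα
  set S := ∑ i ∈ Finset.range (p + r), D i with hS
  have hS0 : 0 ≤ S := Finset.sum_nonneg fun i _ => hD0 i
  -- The trace is at most `(p + r) S²` times the mass `B2` sent to the right of the boundary; the
  -- added `1` keeps the denominator positive.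
  refine ⟨1 / (1 + ((p : ℝ) + r) * S ^ 2), 1, by positivity, zero_le_one, fun v hv => ?_⟩
  set w : ℤ → ℝ := fun j => if j ≤ p then v j else 0 with hw
  have hwv : ∀ j : ℤ, j ≤ p → w j = v j := fun j hj => if_pos hj
  have hw0 : ∀ j : ℤ, (p : ℤ) < j → w j = 0 := fun j hj => if_neg (by omega)
  set B2 := ∑ i ∈ Finset.range (p + r), (stencil r p α w ((i : ℤ) + 1)) ^ 2 with hB2
  have hB20 : 0 ≤ B2 := Finset.sum_nonneg fun _ _ => sq_nonneg _
  have h1 := (energy_stencil_le hα hv hwv (N := p + r) fun j hj => hw0 j (by push_cast at hj; omega)).2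
  rw [Finset.sum_range_add (fun i : ℕ => (w ((i : ℤ) + 1)) ^ 2)] at h1
  have h2 : ∑ i ∈ Finset.range r, (w (((p + i : ℕ) : ℤ) + 1)) ^ 2 = 0 :=
    Finset.sum_eq_zero fun i _ => by rw [hw0 _ (by push_cast; omega)]; norm_num
  have h3 : ∑ i ∈ Finset.range p, (w ((i : ℤ) + 1)) ^ 2 =
      ∑ i ∈ Finset.range p, (v ((i : ℤ) + 1)) ^ 2 :=
    Finset.sum_congr rfl fun i hi => by rw [hwv _ (by have := Finset.mem_range.1 hi; omega)]
  have h4 : boundaryTrace r p v ≤ ((p : ℝ) + r) * (S ^ 2 * B2) := by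
    refine boundaryTrace_le fun j hj1 hj2 => ?_
    obtain ⟨i, hi⟩ : ∃ i : ℕ, j = p - i := ⟨(p - j).toNat, by omega⟩
    have hir : i < p + r := by omega
    have h5 := hD i w p hw0 (Real.sqrt B2) fun i' hi' => by
      rw [← Real.sqrt_sq_eq_abs]
      refine Real.sqrt_le_sqrt ?_
      have : (p : ℤ) + r - i' = ((p + r - 1 - i' : ℕ) : ℤ) + 1 := by omega
      rw [this]
      exact Finset.single_le_sum (f := fun i : ℕ => (stencil r p α w ((i : ℤ) + 1)) ^ 2)
        (fun _ _ => sq_nonneg _) (Finset.mem_range.2 (by omega))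
    rw [← hi, hwv j hj2] at h5
    have h6 : |v j| ≤ S * Real.sqrt B2 := h5.trans (mul_le_mul_of_nonneg_right
      (Finset.single_le_sum (fun i _ => hD0 i) (Finset.mem_range.2 hir)) (Real.sqrt_nonneg _))
    calc (v j) ^ 2 = |v j| ^ 2 := (sq_abs _).symm
      _ ≤ (S * Real.sqrt B2) ^ 2 := pow_le_pow_left₀ (abs_nonneg _) h6 2
      _ = S ^ 2 * B2 := by rw [mul_pow, Real.sq_sqrt hB20]
  have h7 : 1 / (1 + ((p : ℝ) + r) * S ^ 2) * boundaryTrace r p v ≤ B2 := by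
    rw [one_div, inv_mul_le_iff₀ (by positivity)]
    linarith
  linarith

/-! ### Boundary dissipation from the outgoing flux -/

/-- A cutoff equal to `1` on the cells `j ≤ p`, to `0` on the cells `j ≥ p + K`, and affine in
between. -/
noncomputable def cutoff (p K : ℕ) (j : ℤ) : ℝ := max 0 (min 1 (1 - ((j : ℝ) - p) / K))

theorem cutoff_nonneg (p K : ℕ) (j : ℤ) : 0 ≤ cutoff p K j := le_max_left _ _

theorem cutoff_le_one (p K : ℕ) (j : ℤ) : cutoff p K j ≤ 1 :=
  max_le zero_le_one (min_le_left _ _)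

theorem cutoff_eq_one {p K : ℕ} {j : ℤ} (hj : j ≤ p) : cutoff p K j = 1 := by
  have h : ((j : ℝ) - p) / K ≤ 0 := by
    refine div_nonpos_of_nonpos_of_nonneg ?_ (Nat.cast_nonneg _)
    have : (j : ℝ) ≤ p := by exact_mod_cast hj
    linarith
  rw [cutoff, min_eq_left (by linarith), max_eq_right zero_le_one]

theorem cutoff_eq_zero {p K : ℕ} (hK : 0 < K) {j : ℤ} (hj : (p : ℤ) + K ≤ j) :
    cutoff p K j = 0 := by
  have h : 1 ≤ ((j : ℝ) - p) / K := by
    rw [le_div_iff₀ (by exact_mod_cast hK)]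
    have : (p : ℝ) + K ≤ j := by exact_mod_cast hj
    linarith
  rw [cutoff]
  exact max_eq_left ((min_le_right _ _).trans (by linarith))

theorem abs_cutoff_sub_le (p K : ℕ) (i j : ℤ) :
    |cutoff p K i - cutoff p K j| ≤ |(i : ℝ) - j| / K := by
  rw [cutoff, cutoff]
  refine (abs_max_sub_max_le_max _ _ _ _).trans ?_
  rw [sub_self, abs_zero, max_eq_right (abs_nonneg _)]
  refine (abs_min_sub_min_le_max _ _ _ _).trans ?_
  rw [sub_self, abs_zero, max_eq_right (abs_nonneg _), sub_sub_sub_cancel_left, ← sub_div,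
    sub_sub_sub_cancel_right, abs_div, Nat.abs_cast, abs_sub_comm]

/-- Each shift by one cell to the right drops a value `1` from the left end of the window and adds a
value `0` at its right end, so the sum falls by exactly one. -/
theorem sum_range_shift {r p K : ℕ} {f : ℤ → ℝ} (h1 : ∀ j : ℤ, j ≤ p → f j = 1)
    (h0 : ∀ j : ℤ, (p : ℤ) + K ≤ j → f j = 0) {l : ℤ} (hl : l ∈ Finset.Icc (-(r : ℤ)) (p : ℤ)) :
    ∑ i ∈ Finset.range (p + K + r), (f ((i : ℤ) + 1 + l) - f ((i : ℤ) + 1)) = -(l : ℝ) := by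
  have key : ∀ m : ℕ, m ≤ p + r →
      ∑ i ∈ Finset.range (p + K + r), f ((i : ℤ) + 1 + (-(r : ℤ) + m)) =
        ∑ i ∈ Finset.range (p + K + r), f ((i : ℤ) + 1 + -(r : ℤ)) - m := by
    intro m
    induction m with
    | zero => simp
    | succ m ih =>
      intro hm
      have h2 := Finset.sum_range_succ (fun i : ℕ => f ((i : ℤ) + 1 + (-(r : ℤ) + m))) (p + K + r)
      rw [Finset.sum_range_succ', ih (by omega)] at h2
      rw [h1 (((0 : ℕ) : ℤ) + 1 + (-(r : ℤ) + m)) (by push_cast; omega),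
        h0 (((p + K + r : ℕ) : ℤ) + 1 + (-(r : ℤ) + m)) (by push_cast; omega)] at h2
      have h3 : ∀ i : ℕ, (i : ℤ) + 1 + (-(r : ℤ) + ((m + 1 : ℕ) : ℤ)) =
          ((i + 1 : ℕ) : ℤ) + 1 + (-(r : ℤ) + m) := fun i => by push_cast; ring
      simp only [h3]
      push_cast at h2 ⊢
      linarith
  rw [Finset.mem_Icc] at hl
  have k1 := key (l + r).toNat (by omega)
  have k2 := key r (by omega)
  have e1 : -(r : ℤ) + ((l + r).toNat : ℤ) = l := by omega
  have e2 : (((l + r).toNat : ℕ) : ℝ) = (l : ℝ) + r := by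
    have : (((l + r).toNat : ℕ) : ℤ) = l + r := by omega
    exact_mod_cast this
  rw [e1, e2] at k1
  simp only [neg_add_cancel, add_zero] at k2
  rw [Finset.sum_sub_distrib, k1, k2]
  ring

/-- The flux created by a slowly varying cutoff is that of the transport equation, up to a small
error. -/
theorem sum_cutoff_flux_le {a lam : ℝ} {k r p : ℕ} {α : ℤ → ℝ} (hk : 1 ≤ k)
    (hα : SchemeAssumption a lam k r p α) {K : ℕ} (hK : 0 < K) :
    ∑ i ∈ Finset.range (p + K + r), ((cutoff p K ((i : ℤ) + 1)) ^ 2 -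
        (stencil r p α (cutoff p K) ((i : ℤ) + 1)) ^ 2) ≤
      -(lam * a) + (∑ l ∈ Finset.Icc (-(r : ℤ)) (p : ℤ), |α l|) *
        ((1 + (p + r)) * (p + r) ^ 2) / K := by
  set χ := cutoff p K with hχ
  set I := Finset.Icc (-(r : ℤ)) (p : ℤ) with hI
  have hK0 : (0 : ℝ) < K := by exact_mod_cast hK
  have m0 : ∑ l ∈ I, α l = 1 := by simpa using hα.consistent 0 (by omega)
  have m1 : ∑ l ∈ I, (l : ℝ) * α l = -(lam * a) := by simpa using hα.consistent 1 hk
  have hpt : ∀ j : ℤ, (χ j) ^ 2 - (stencil r p α χ j) ^ 2 ≤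
      ∑ l ∈ I, (-(α l) * ((χ (j + l)) ^ 2 - (χ j) ^ 2) + |α l| * (((p : ℝ) + r) / K) ^ 2) := by
    intro j
    have e : stencil r p α χ j = χ j + ∑ l ∈ I, α l * (χ (j + l) - χ j) := by
      simp only [mul_sub, Finset.sum_sub_distrib, ← Finset.sum_mul, m0, stencil]
      ring
    -- The square of the increment is dropped, having the good sign. Then `-2x(y - x) = -(y² - x²) +
    -- (y - x)²` separates a telescoping part from a quadratic one of size `1 / K²`.
    have h1 : (χ j) ^ 2 - (stencil r p α χ j) ^ 2 ≤
        ∑ l ∈ I, -2 * χ j * (α l * (χ (j + l) - χ j)) := by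
      rw [← Finset.mul_sum, e]
      linarith [sq_nonneg (∑ l ∈ I, α l * (χ (j + l) - χ j))]
    refine h1.trans (Finset.sum_le_sum fun l hl => ?_)
    have hl' := Finset.mem_Icc.1 hl
    have h2 : |χ (j + l) - χ j| ≤ ((p : ℝ) + r) / K := by
      refine (abs_cutoff_sub_le p K (j + l) j).trans ?_
      refine div_le_div_of_nonneg_right ?_ hK0.le
      have a1 : -(r : ℝ) ≤ l := by exact_mod_cast hl'.1
      have a2 : (l : ℝ) ≤ p := by exact_mod_cast hl'.2
      have a3 : (0 : ℝ) ≤ r := Nat.cast_nonneg _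
      have a4 : (0 : ℝ) ≤ p := Nat.cast_nonneg _
      rw [Int.cast_add, add_sub_cancel_left, abs_le]
      constructor <;> linarith
    have h3 : (χ (j + l) - χ j) ^ 2 ≤ (((p : ℝ) + r) / K) ^ 2 := by
      rw [← sq_abs]
      exact pow_le_pow_left₀ (abs_nonneg _) h2 2
    have h4 : α l * (χ (j + l) - χ j) ^ 2 ≤ |α l| * (((p : ℝ) + r) / K) ^ 2 :=
      (mul_le_mul_of_nonneg_right (le_abs_self _) (sq_nonneg _)).trans
        (mul_le_mul_of_nonneg_left h3 (abs_nonneg _))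
    linarith
  refine (Finset.sum_le_sum fun i _ => hpt _).trans ?_
  rw [Finset.sum_comm]
  simp only [Finset.sum_add_distrib, ← Finset.mul_sum]
  have hsh : ∀ l ∈ I, -α l * ∑ i ∈ Finset.range (p + K + r),
      ((χ ((i : ℤ) + 1 + l)) ^ 2 - (χ ((i : ℤ) + 1)) ^ 2) = (l : ℝ) * α l := by
    intro l hl
    rw [sum_range_shift (f := fun j => (χ j) ^ 2) (fun j hj => ?_) (fun j hj => ?_) hl]
    · ring
    · simp only [hχ, cutoff_eq_one hj, one_pow]
    · simp only [hχ, cutoff_eq_zero hK hj]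
      norm_num
  rw [Finset.sum_congr rfl hsh, m1, ← Finset.sum_mul]
  refine add_le_add_right ?_ _
  rw [Finset.sum_const, Finset.card_range, nsmul_eq_mul, mul_div_assoc]
  set S := ∑ l ∈ I, |α l|
  have hS : 0 ≤ S := Finset.sum_nonneg fun _ _ => abs_nonneg _
  have hK1 : (1 : ℝ) ≤ K := by exact_mod_cast hK
  have hR : (0 : ℝ) ≤ (p : ℝ) + r := by positivity
  refine mul_le_mul_of_nonneg_left ?_ hS
  rw [div_pow, mul_div_assoc', div_le_div_iff₀ (by positivity) hK0]
  push_cast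
  -- About `K` terms of size `1 / K²` leave an error of order `1 / K`; `K ≥ 1` absorbs the extra `p
  -- + r` terms.
  have : ((p : ℝ) + K + r) * K ≤ (1 + (p + r)) * K ^ 2 := by
    linarith [mul_nonneg (mul_nonneg hR hK0.le) (sub_nonneg.2 hK1)]
  linarith [mul_le_mul_of_nonneg_right this (sq_nonneg ((p : ℝ) + r))]

theorem abs_sub_le_of_abs_Dminus_le {v : ℤ → ℝ} {G : ℝ} {i : ℤ} {m : ℕ}
    (h : ∀ j, i < j → j ≤ i + m → |Dminus v j| ≤ G) : |v (i + m) - v i| ≤ m * G := by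
  induction m with
  | zero => simp
  | succ m ih =>
    have h1 := ih fun j hj1 hj2 => h j hj1 (by push_cast; omega)
    have h2 := h (i + (m + 1 : ℕ)) (by push_cast; omega) le_rfl
    rw [Dminus, show i + ((m + 1 : ℕ) : ℤ) - 1 = i + m by push_cast; ring] at h2
    have := abs_sub_le (v (i + (m + 1 : ℕ))) (v (i + m)) (v i)
    push_cast at *
    linarith

/-- Energy estimate with dissipation at the boundary, when the gradient at the boundary is
controlled. -/
theorem exists_energy_neumann {a lam : ℝ} {k r p : ℕ} {α : ℤ → ℝ} (ha : 0 < a) (hlam : 0 < lam)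
    (hk : 1 ≤ k) (hp : 1 ≤ p) (hα : SchemeAssumption a lam k r p α) :
    ∃ c C : ℝ, 0 < c ∧ 0 ≤ C ∧ ∀ v, FiniteEnergy v →
      energy (stencil r p α v) + c * boundaryTrace r p v ≤
        energy v + C * boundaryTrace r p (Dminus v) := by
  set S := ∑ l ∈ Finset.Icc (-(r : ℤ)) (p : ℤ), |α l| with hS
  have hS0 : 0 ≤ S := Finset.sum_nonneg fun _ _ => abs_nonneg _
  set R : ℝ := (p : ℝ) + r with hR
  have hR1 : 1 ≤ R := by
    have : (1 : ℝ) ≤ p := by exact_mod_cast hp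
    have : (0 : ℝ) ≤ r := Nat.cast_nonneg _
    linarith
  set q : ℝ := lam * a / 2 with hq
  have hq0 : 0 < q := by positivity
  -- The flux is `-(lam * a) = -2 q` up to an error of order `1 / K`; `K` is taken so large that
  -- this error is at most `q`.
  obtain ⟨K, hK, hflux⟩ : ∃ K : ℕ, 0 < K ∧
      ∑ i ∈ Finset.range (p + K + r), ((cutoff p K ((i : ℤ) + 1)) ^ 2 -
        (stencil r p α (cutoff p K) ((i : ℤ) + 1)) ^ 2) ≤ -q := by
    obtain ⟨K, hK⟩ := exists_nat_gt (S * ((1 + R) * R ^ 2) / q)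
    have hK0 : (0 : ℝ) < K := lt_of_le_of_lt (by positivity) hK
    refine ⟨K, by exact_mod_cast hK0, (sum_cutoff_flux_le hk hα (by exact_mod_cast hK0)).trans ?_⟩
    have : S * ((1 + R) * R ^ 2) / K ≤ q := by
      rw [div_lt_iff₀ hq0] at hK
      rw [div_le_iff₀ hK0]
      linarith
    linarith
  set N := p + K + r with hN
  set P : ℝ := N * ((1 + S ^ 2) * R) with hP
  have hP0 : 0 ≤ P := by positivity
  -- Half of the gain `q c²` absorbs the cross term `2 |c| P G`, at the cost `2 P² G² / q`. The
  -- other half pays for the trace, which is at most `2 R (c² + R² G²)`. The term `N R²` comes from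
  -- the squares of `d`.
  refine ⟨q / 2 / (2 * R), 2 * P ^ 2 / q + N * R ^ 2 + q / 2 * R ^ 2, by positivity,
    by positivity, fun v hv => ?_⟩
  set χ := cutoff p K with hχ
  set c := v 1 with hc
  set G := Real.sqrt (boundaryTrace r p (Dminus v)) with hG
  have hG0 : 0 ≤ G := Real.sqrt_nonneg _
  have hG2 : G ^ 2 = boundaryTrace r p (Dminus v) := Real.sq_sqrt (boundaryTrace_nonneg _ _ _)
  have hD : ∀ j : ℤ, -(r : ℤ) < j → j ≤ p → |Dminus v j| ≤ G := by
    intro j h1 h2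
    rw [← Real.sqrt_sq_eq_abs]
    exact Real.sqrt_le_sqrt (Finset.single_le_sum (f := fun j => (Dminus v j) ^ 2)
      (fun _ _ => sq_nonneg _) (Finset.mem_Ioc.2 ⟨h1, h2⟩))
  have hvc : ∀ j : ℤ, -(r : ℤ) < j → j ≤ p → |v j - c| ≤ R * G := by
    intro j h1 h2
    have aux : ∀ m : ℕ, m ≤ p + r → (m : ℝ) * G ≤ R * G := fun m hm =>
      mul_le_mul_of_nonneg_right (by rw [hR]; exact_mod_cast hm) hG0
    rcases le_total 1 j with h | h
    · obtain ⟨m, rfl⟩ : ∃ m : ℕ, j = 1 + m := ⟨(j - 1).toNat, by omega⟩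
      exact (abs_sub_le_of_abs_Dminus_le fun i hi1 hi2 => hD i (by omega) (by omega)).trans
        (aux m (by omega))
    · obtain ⟨m, hm⟩ : ∃ m : ℕ, (1 : ℤ) = j + m := ⟨(1 - j).toNat, by omega⟩
      rw [abs_sub_comm, hc, hm]
      exact (abs_sub_le_of_abs_Dminus_le fun i hi1 hi2 => hD i (by omega) (by omega)).trans
        (aux m (by omega))
  set w : ℤ → ℝ := fun j => if j ≤ p then v j else c * χ j with hw
  have hwv : ∀ j : ℤ, j ≤ p → w j = v j := fun j hj => if_pos hj
  have hw0 : ∀ j : ℤ, (N : ℤ) - r < j → w j = 0 := fun j hj => by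
    have hj' : (p : ℤ) + K < j := by rw [hN] at hj; push_cast at hj; linarith
    simp only [hw]
    rw [if_neg (by omega), hχ, cutoff_eq_zero hK (by omega), mul_zero]
  -- The deviation from the pure profile `c χ` vanishes beyond the ghost cells and is `O(G)` on the
  -- cells `j > -r`, which are all that the stencil at `j ≥ 1` sees.
  set d : ℤ → ℝ := fun j => w j - c * χ j with hd
  have hd1 : ∀ j : ℤ, -(r : ℤ) < j → |d j| ≤ R * G := by
    intro j hj
    rcases le_or_gt j (p : ℤ) with h | h
    · simp only [hd]
      rw [hwv j h, hχ, cutoff_eq_one h, mul_one]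
      exact hvc j hj h
    · simp only [hd, hw]
      rw [if_neg (by omega), sub_self, abs_zero]
      positivity
  have hAw : ∀ j, stencil r p α w j = c * stencil r p α χ j + stencil r p α d j := by
    intro j
    simp only [stencil, Finset.mul_sum, ← Finset.sum_add_distrib, hd]
    exact Finset.sum_congr rfl fun l _ => by ring
  have hpt : ∀ i : ℕ, (w ((i : ℤ) + 1)) ^ 2 - (stencil r p α w ((i : ℤ) + 1)) ^ 2 ≤
      c ^ 2 * ((χ ((i : ℤ) + 1)) ^ 2 - (stencil r p α χ ((i : ℤ) + 1)) ^ 2) +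
        (2 * |c| * ((1 + S ^ 2) * R * G) + R ^ 2 * G ^ 2) := by
    intro i
    set j : ℤ := (i : ℤ) + 1 with hj
    have b1 : |χ j * d j| ≤ 1 * (R * G) := by
      rw [abs_mul]
      refine mul_le_mul ?_ (hd1 j (by omega)) (abs_nonneg _) zero_le_one
      rw [abs_of_nonneg (cutoff_nonneg _ _ _)]
      exact cutoff_le_one _ _ _
    have b2 : |stencil r p α χ j * stencil r p α d j| ≤ (S * 1) * (S * (R * G)) := by
      rw [abs_mul]
      refine mul_le_mul (abs_stencil_le fun i _ _ => ?_)
        (abs_stencil_le fun i hi _ => hd1 i (by omega)) (abs_nonneg _) (by positivity)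
      rw [abs_of_nonneg (cutoff_nonneg _ _ _)]
      exact cutoff_le_one _ _ _
    have b3 : |c * (χ j * d j - stencil r p α χ j * stencil r p α d j)| ≤
        |c| * ((1 + S ^ 2) * R * G) := by
      rw [abs_mul]
      refine mul_le_mul_of_nonneg_left ((abs_sub _ _).trans ?_) (abs_nonneg _)
      linarith
    have b4 : (d j) ^ 2 ≤ R ^ 2 * G ^ 2 := by
      rw [← sq_abs, ← mul_pow]
      exact pow_le_pow_left₀ (abs_nonneg _) (hd1 j (by omega)) 2
    have e1 : w j = c * χ j + d j := by simp only [hd]; ring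
    rw [hAw, e1]
    have := le_abs_self (c * (χ j * d j - stencil r p α χ j * stencil r p α d j))
    linarith [sq_nonneg (stencil r p α d j)]
  have h1 := (energy_stencil_le hα hv hwv hw0).2
  have h2 := Finset.sum_le_sum fun i (_ : i ∈ Finset.range N) => hpt i
  rw [Finset.sum_sub_distrib, Finset.sum_add_distrib, ← Finset.mul_sum, Finset.sum_const,
    Finset.card_range, nsmul_eq_mul] at h2
  have h3 := mul_le_mul_of_nonneg_left hflux (sq_nonneg c)
  have h4 : 2 * |c| * (P * G) ≤ q / 2 * c ^ 2 + 2 * P ^ 2 / q * G ^ 2 := by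
    have e : q / 2 * c ^ 2 + 2 * P ^ 2 / q * G ^ 2 - 2 * |c| * (P * G) =
        (q * |c| - 2 * (P * G)) ^ 2 / (2 * q) := by
      rw [← sq_abs c]
      field_simp
      ring
    have : 0 ≤ (q * |c| - 2 * (P * G)) ^ 2 / (2 * q) := by positivity
    linarith
  have h5 : boundaryTrace r p v ≤ R * (2 * c ^ 2 + 2 * (R ^ 2 * G ^ 2)) := by
    refine boundaryTrace_le fun j hj1 hj2 => ?_
    have b := hvc j hj1 hj2
    have b4 : (v j - c) ^ 2 ≤ R ^ 2 * G ^ 2 := by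
      rw [← sq_abs, ← mul_pow]
      exact pow_le_pow_left₀ (abs_nonneg _) b 2
    linarith [sq_nonneg (v j - 2 * c)]
  have h6 : q / 2 / (2 * R) * boundaryTrace r p v ≤ q / 2 * (c ^ 2 + R ^ 2 * G ^ 2) := by
    calc q / 2 / (2 * R) * boundaryTrace r p v
        ≤ q / 2 / (2 * R) * (R * (2 * c ^ 2 + 2 * (R ^ 2 * G ^ 2))) :=
          mul_le_mul_of_nonneg_left h5 (by positivity)
      _ = q / 2 * (c ^ 2 + R ^ 2 * G ^ 2) := by field_simp
  rw [← hG2]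
  have h7 : (N : ℝ) * (2 * |c| * ((1 + S ^ 2) * R * G) + R ^ 2 * G ^ 2) =
      2 * |c| * (P * G) + N * R ^ 2 * G ^ 2 := by rw [hP]; ring
  rw [h7] at h2
  linarith

/-! ### Gronwall estimate and stability by induction on the Neumann order -/

theorem FiniteEnergy.add {v w : ℤ → ℝ} (hv : FiniteEnergy v) (hw : FiniteEnergy w) :
    FiniteEnergy fun j => v j + w j :=
  Summable.of_nonneg_of_le (fun _ => sq_nonneg _)
    (fun i => by linarith [sq_nonneg (v (-(i : ℤ)) - w (-(i : ℤ)))])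
    ((Summable.mul_left 2 hv).add (Summable.mul_left 2 hw))

theorem energy_add_le {v w : ℤ → ℝ} (hv : FiniteEnergy v) (hw : FiniteEnergy w) {δ : ℝ}
    (hδ : 0 < δ) :
    energy (fun j => v j + w j) ≤ (1 + δ) * energy v + (1 + 1 / δ) * energy w := by
  rw [energy, energy, energy, ← tsum_mul_left, ← tsum_mul_left,
    ← (Summable.mul_left _ hv).tsum_add (Summable.mul_left _ hw)]
  refine (hv.add hw).tsum_le_tsum (fun i => ?_) ((Summable.mul_left _ hv).add
    (Summable.mul_left _ hw))
  set x := v (-(i : ℤ))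
  set y := w (-(i : ℤ))
  have : (1 + δ) * x ^ 2 + (1 + 1 / δ) * y ^ 2 - (x + y) ^ 2 = (δ * x - y) ^ 2 / δ := by
    field_simp
    ring
  have : 0 ≤ (δ * x - y) ^ 2 / δ := by positivity
  linarith

theorem FiniteEnergy.shift {v : ℤ → ℝ} (hv : FiniteEnergy v) : FiniteEnergy fun j => v (j - 1) := by
  have h := (summable_nat_add_iff 1).2 hv
  refine Summable.congr h fun i => ?_
  congr 2
  push_cast
  ring

theorem energy_shift_le {v : ℤ → ℝ} (hv : FiniteEnergy v) :
    energy (fun j => v (j - 1)) ≤ energy v := by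
  have h1 : energy v = (v 0) ^ 2 + energy (fun j => v (j - 1)) := by
    rw [energy, Summable.tsum_eq_zero_add hv, energy]
    have : ∀ i : ℕ, v (-((i + 1 : ℕ) : ℤ)) = v (-(i : ℤ) - 1) := fun i => by
      congr 1
      push_cast
      ring
    simp only [this, Nat.cast_zero, neg_zero]
  linarith [sq_nonneg (v 0)]

theorem FiniteEnergy.Dminus {v : ℤ → ℝ} (hv : FiniteEnergy v) :
    FiniteEnergy (Dminus v) ∧ energy (NeumannScheme.Dminus v) ≤ 4 * energy v := by
  have h2 : FiniteEnergy fun j => -v (j - 1) :=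
    Summable.congr hv.shift fun i => (neg_sq _).symm
  have e2 : energy (fun j => -v (j - 1)) = energy fun j => v (j - 1) :=
    tsum_congr fun i => neg_sq _
  have e : NeumannScheme.Dminus v = fun j => v j + -v (j - 1) := by
    funext j
    rw [NeumannScheme.Dminus, sub_eq_add_neg]
  rw [e]
  refine ⟨hv.add h2, (energy_add_le hv h2 one_pos).trans ?_⟩
  rw [e2]
  linarith [energy_shift_le hv]

/-- This commutation is what drives the induction on the Neumann order. -/
theorem Dminus_stencil (r p : ℕ) (α : ℤ → ℝ) (v : ℤ → ℝ) (j : ℤ) :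
    Dminus (stencil r p α v) j = stencil r p α (Dminus v) j := by
  simp only [Dminus, stencil, ← Finset.sum_sub_distrib]
  refine Finset.sum_congr rfl fun l _ => ?_
  rw [show j - 1 + l = j + l - 1 by ring]
  ring

/-- Discrete Gronwall estimate for the forced scheme, from an energy inequality for one step. -/
theorem energy_gronwall {r p : ℕ} {α : ℤ → ℝ} {c C : ℝ} (hC : 0 ≤ C)
    {β : (ℤ → ℝ) → ℝ} (hβ : ∀ v, 0 ≤ β v)
    (hstep : ∀ v, FiniteEnergy v → FiniteEnergy (stencil r p α v) ∧
      energy (stencil r p α v) + c * boundaryTrace r p v ≤ energy v + C * β v)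
    (hc : 0 < c) {N : ℕ} {e F : ℕ → ℤ → ℝ} {Φ : ℝ} (hΦ : 0 ≤ Φ) (h0 : ∀ j ≤ 0, e 0 j = 0)
    (hrec : ∀ n < N, ∀ j ≤ 0, e (n + 1) j = stencil r p α (e n) j + F n j)
    (hF : ∀ n < N, FiniteEnergy (F n) ∧ energy (F n) ≤ Φ) {n : ℕ} (hn : n ≤ N) :
    FiniteEnergy (e n) ∧ energy (e n) + c * ∑ m ∈ Finset.range n, boundaryTrace r p (e m) ≤
      3 * (C * ∑ m ∈ Finset.range n, β (e m) + 2 * N ^ 2 * Φ) := by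
  -- The forcing is split off by Young's inequality with parameter `1 / N`: the growth over `N`
  -- steps stays below `exp 1 ≤ 3`, and each step adds `(1 + N) Φ`, whence the `N² Φ`.
  have key : ∀ n ≤ N, FiniteEnergy (e n) ∧
      energy (e n) + c * ∑ m ∈ Finset.range n, boundaryTrace r p (e m) ≤
      (1 + 1 / (N : ℝ)) ^ n * (C * ∑ m ∈ Finset.range n, β (e m) + n * (1 + N) * Φ) := by
    intro n
    induction n with
    | zero =>
      intro _
      have hs : ∀ i : ℕ, (e 0 (-(i : ℤ))) ^ 2 = 0 := fun i => by rw [h0 _ (by omega)]; norm_num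
      refine ⟨?_, ?_⟩
      · simp only [FiniteEnergy, hs]
        exact summable_zero
      · simp [energy, hs]
    | succ n ih =>
      intro hn
      obtain ⟨hfin, hle⟩ := ih (by omega)
      obtain ⟨hfA, hA⟩ := hstep _ hfin
      obtain ⟨hfF, hFle⟩ := hF n (by omega)
      have hN : (0 : ℝ) < N := by exact_mod_cast (by omega : 0 < N)
      have hδ : 0 < 1 / (N : ℝ) := by positivity
      have hrec' : ∀ j ≤ 0, stencil r p α (e n) j + F n j = e (n + 1) j := fun j hj =>
        (hrec n (by omega) j hj).symm
      refine ⟨(hfA.add hfF).congr hrec', ?_⟩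
      rw [← energy_congr hrec']
      have h1 := energy_add_le hfA hfF hδ
      rw [one_div_one_div] at h1
      rw [Finset.sum_range_succ, Finset.sum_range_succ]
      set δ := 1 / (N : ℝ) with hδd
      set X := ∑ m ∈ Finset.range n, boundaryTrace r p (e m)
      set Y := ∑ m ∈ Finset.range n, β (e m)
      have hX : 0 ≤ X := Finset.sum_nonneg fun _ _ => boundaryTrace_nonneg _ _ _
      have ht := boundaryTrace_nonneg r p (e n)
      have hpow : 1 ≤ (1 + δ) ^ n := one_le_pow₀ (by linarith)
      have h2 : (1 + (N : ℝ)) * energy (F n) ≤ (1 + N) * Φ :=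
        mul_le_mul_of_nonneg_left hFle (by positivity)
      have h3 : (1 + (N : ℝ)) * Φ ≤ (1 + δ) ^ (n + 1) * ((1 + N) * Φ) :=
        le_mul_of_one_le_left (by positivity) (one_le_pow₀ (by linarith))
      have h4 : C * β (e n) ≤ (1 + δ) ^ n * (C * β (e n)) :=
        le_mul_of_one_le_left (mul_nonneg hC (hβ _)) hpow
      have h5 := mul_le_mul_of_nonneg_left (add_le_add hA (add_le_add hle h4))
        (by linarith : 0 ≤ 1 + δ)
      have h6 : 0 ≤ δ * (c * X) := by positivity
      have h7 : 0 ≤ δ * (c * boundaryTrace r p (e n)) := by positivity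
      rw [pow_succ] at h3 ⊢
      push_cast
      linarith
  obtain ⟨h1, h2⟩ := key n hn
  refine ⟨h1, h2.trans ?_⟩
  have hsum : 0 ≤ ∑ m ∈ Finset.range n, β (e m) := Finset.sum_nonneg fun _ _ => hβ _
  rcases Nat.eq_zero_or_pos N with rfl | hN
  · obtain rfl : n = 0 := by omega
    simp
  have hN1 : (1 : ℝ) ≤ N := by exact_mod_cast hN
  have hnN : (n : ℝ) ≤ N := by exact_mod_cast hn
  have hexp : (1 + 1 / (N : ℝ)) ^ n ≤ 3 := by
    have h3 : 1 + 1 / (N : ℝ) ≤ Real.exp (1 / N) := by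
      linarith [Real.add_one_le_exp (1 / (N : ℝ))]
    calc (1 + 1 / (N : ℝ)) ^ n ≤ (1 + 1 / (N : ℝ)) ^ N :=
          pow_le_pow_right₀ (by linarith [show 0 ≤ 1 / (N : ℝ) by positivity]) hn
      _ ≤ Real.exp (1 / N) ^ N := pow_le_pow_left₀ (by positivity) h3 N
      _ = Real.exp 1 := by
          rw [← Real.exp_nat_mul, mul_one_div_cancel (by positivity)]
      _ ≤ 3 := Real.exp_one_lt_three.le
  have h4 : (n : ℝ) * (1 + N) * Φ ≤ 2 * N ^ 2 * Φ := by
    refine mul_le_mul_of_nonneg_right ?_ hΦ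
    calc (n : ℝ) * (1 + N) ≤ N * (N + N) := mul_le_mul hnN (by linarith) (by positivity)
          (by positivity)
      _ = 2 * N ^ 2 := by ring
  exact mul_le_mul hexp (by linarith) (by positivity) (by norm_num)

/-- Stability of the scheme with inhomogeneous Neumann boundary data. -/
theorem exists_stability {a lam : ℝ} {k r p : ℕ} {α : ℤ → ℝ} (ha : 0 < a) (hlam : 0 < lam)
    (hk : 1 ≤ k) (hp : 1 ≤ p) (hα : SchemeAssumption a lam k r p α) (kb : ℕ) :
    ∃ C : ℝ, 0 ≤ C ∧ ∀ (N : ℕ) (e F : ℕ → ℤ → ℝ) (Φ Γ : ℝ), 0 ≤ Φ → 0 ≤ Γ →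
      (∀ j ≤ 0, e 0 j = 0) →
      (∀ n < N, ∀ j ≤ 0, e (n + 1) j = stencil r p α (e n) j + F n j) →
      (∀ n < N, FiniteEnergy (F n) ∧ energy (F n) ≤ Φ) →
      (∀ n < N, ∑ i ∈ Finset.range p, (Dminus^[kb] (e n) ((i : ℤ) + 1)) ^ 2 ≤ Γ) →
      ∀ n ≤ N, FiniteEnergy (e n) ∧
        energy (e n) + ∑ m ∈ Finset.range n, boundaryTrace r p (e m) ≤
          C * (N ^ 2 * Φ + N * Γ) := by
  have hfin : ∀ v, FiniteEnergy v → FiniteEnergy (stencil r p α v) := fun v hv =>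
    (energy_stencil_le hα hv (w := fun j => if j ≤ p then v j else 0) (N := p + r)
      (fun j hj => if_pos hj) fun j hj => if_neg (by push_cast at hj; omega)).1
  have hcomb : ∀ {c E t X : ℝ}, 0 < c → 0 ≤ E → 0 ≤ t → E + c * t ≤ X →
      E + t ≤ (1 + 1 / c) * X := by
    intro c E t X hc hE ht h
    have h1 : t ≤ 1 / c * X := by
      rw [one_div, ← div_eq_inv_mul, le_div_iff₀ hc]
      linarith
    have h2 : 0 ≤ c * t := by positivity
    linarith
  have htr : ∀ (n : ℕ) (e : ℕ → ℤ → ℝ), 0 ≤ ∑ m ∈ Finset.range n, boundaryTrace r p (e m) :=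
    fun n e => Finset.sum_nonneg fun _ _ => boundaryTrace_nonneg _ _ _
  induction kb with
  | zero =>
    obtain ⟨c, C, hc, hC, hstep⟩ := exists_energy_dirichlet hα
    have hc1 : 0 ≤ 1 + 1 / c := by positivity
    refine ⟨(1 + 1 / c) * (3 * (C + 2)), by positivity,
      fun N e F Φ Γ hΦ hΓ h0 hrec hF hΓe n hn => ?_⟩
    obtain ⟨h1, h2⟩ := energy_gronwall (β := fun v => ∑ i ∈ Finset.range p, (v ((i : ℤ) + 1)) ^ 2) hC
      (fun v => Finset.sum_nonneg fun _ _ => sq_nonneg _) (fun v hv => ⟨hfin v hv, hstep v hv⟩)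
      hc hΦ h0 hrec hF hn
    refine ⟨h1, (hcomb hc (energy_nonneg (e n)) (htr n e) h2).trans ?_⟩
    rw [mul_assoc (1 + 1 / c)]
    refine mul_le_mul_of_nonneg_left ?_ hc1
    have h3 : ∑ m ∈ Finset.range n, ∑ i ∈ Finset.range p, (e m ((i : ℤ) + 1)) ^ 2 ≤ N * Γ := by
      refine (Finset.sum_le_card_nsmul _ _ Γ fun m hm =>
        hΓe m ((Finset.mem_range.1 hm).trans_le hn)).trans ?_
      rw [Finset.card_range, nsmul_eq_mul]
      exact mul_le_mul_of_nonneg_right (by exact_mod_cast hn) hΓ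
    have h4 := mul_le_mul_of_nonneg_left h3 hC
    have h5 : 0 ≤ C * (N ^ 2 * Φ) := by positivity
    have h6 : 0 ≤ N * Γ := by positivity
    linarith
  | succ kb ih =>
    obtain ⟨C', hC', ih⟩ := ih
    obtain ⟨c, C, hc, hC, hstep⟩ := exists_energy_neumann ha hlam hk hp hα
    have hc1 : 0 ≤ 1 + 1 / c := by positivity
    refine ⟨(1 + 1 / c) * (3 * (C * (4 * C') + 2)), by positivity,
      fun N e F Φ Γ hΦ hΓ h0 hrec hF hΓe n hn => ?_⟩
    obtain ⟨h1, h2⟩ := energy_gronwall (β := fun v => boundaryTrace r p (Dminus v)) hC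
      (fun v => boundaryTrace_nonneg _ _ _) (fun v hv => ⟨hfin v hv, hstep v hv⟩)
      hc hΦ h0 hrec hF hn
    -- The differenced error has the same boundary data, one order lower, and a forcing whose energy
    -- grows by at most `4`. The induction hypothesis thus bounds the trace of `Dminus (e m)` that
    -- `exists_energy_neumann` leaves on the right.
    obtain ⟨-, h3⟩ := ih N (fun n => Dminus (e n)) (fun n => Dminus (F n)) (4 * Φ) Γ (by positivity)
      hΓ (fun j hj => by rw [Dminus, h0 j hj, h0 (j - 1) (by omega), sub_zero])
      (fun n hn j hj => by
        rw [← Dminus_stencil, Dminus, hrec n hn j hj, hrec n hn (j - 1) (by omega), Dminus, Dminus]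
        ring)
      (fun n hn => ⟨(hF n hn).1.Dminus.1,
        (hF n hn).1.Dminus.2.trans (mul_le_mul_of_nonneg_left (hF n hn).2 (by norm_num))⟩)
      hΓe n hn
    refine ⟨h1, (hcomb hc (energy_nonneg (e n)) (htr n e) h2).trans ?_⟩
    rw [mul_assoc (1 + 1 / c)]
    refine mul_le_mul_of_nonneg_left ?_ hc1
    have h4 : ∑ m ∈ Finset.range n, boundaryTrace r p (Dminus (e m)) ≤
        4 * C' * (N ^ 2 * Φ + N * Γ) := by
      have h5 : 0 ≤ C' * (N * Γ) := by positivity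
      linarith [energy_nonneg (Dminus (e n))]
    have h6 := mul_le_mul_of_nonneg_left h4 hC
    have h7 : 0 ≤ N * Γ := by positivity
    linarith

/-! ### Weak derivatives and primitives on a half-line -/

theorem exists_Ioc_of_compact_subset_Iio {L : ℝ} {K : Set ℝ} (hK : IsCompact K)
    (hKL : K ⊆ Set.Iio L) : ∃ A B, A < B ∧ B < L ∧ K ⊆ Set.Ioc A B := by
  have hc : IsCompact (insert (L - 1) K) := hK.insert _
  have hne : (insert (L - 1) K).Nonempty := ⟨_, Set.mem_insert _ _⟩
  obtain ⟨A, hA, hA'⟩ := hc.exists_isLeast hne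
  obtain ⟨B, hB, hB'⟩ := hc.exists_isGreatest hne
  refine ⟨A - 1, B, by linarith [hA' hB], ?_, fun x hx => ⟨?_, hB' (Set.mem_insert_of_mem _ hx)⟩⟩
  · rcases hB with rfl | h
    · linarith
    · exact hKL h
  · linarith [hA' (Set.mem_insert_of_mem _ hx)]

theorem setIntegral_Iio_eq_integral {L : ℝ} {f : ℝ → ℝ} (hf : ∀ x, L ≤ x → f x = 0) :
    ∫ x in Set.Iio L, f x = ∫ x, f x :=
  setIntegral_eq_integral_of_forall_compl_eq_zero fun x hx => hf x (not_lt.1 hx)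

theorem setIntegral_Iio_eq_intervalIntegral {A L : ℝ} (hAL : A ≤ L) {f : ℝ → ℝ}
    (hf : ∀ x, x ∉ Set.Ioo A L → f x = 0) :
    ∫ x in Set.Iio L, f x = ∫ x in A..L, f x := by
  rw [setIntegral_Iio_eq_integral fun x hx => hf x fun h => (h.2.trans_le hx).false,
    intervalIntegral.integral_of_le hAL]
  exact (setIntegral_eq_integral_of_forall_compl_eq_zero fun x hx =>
    hf x fun h => hx (Set.Ioo_subset_Ioc_self h)).symm

theorem intervalIntegrable_of_locallyIntegrable {f : ℝ → ℝ} (hf : LocallyIntegrable f) (a b : ℝ) :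
    IntervalIntegrable f volume a b :=
  intervalIntegrable_iff.2 ((hf.integrableOn_isCompact isCompact_uIcc).mono_set
    Set.uIoc_subset_uIcc)

/-- Integration by parts of a primitive against a test function. -/
theorem integral_primitive_mul_deriv {L : ℝ} {G φ : ℝ → ℝ} (hG : LocallyIntegrable G)
    (hφ : ContDiff ℝ (⊤ : ℕ∞) φ) (hc : HasCompactSupport φ) (hs : tsupport φ ⊆ Set.Iio L) :
    ∫ x in Set.Iio L, (∫ t in L..x, G t) * deriv φ x = -∫ x in Set.Iio L, G x * φ x := by
  obtain ⟨A, B, hAB, hBL, hK⟩ := exists_Ioc_of_compact_subset_Iio hc hs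
  have hout : ∀ x, x ∉ Set.Ioo A L → x ∉ tsupport φ := fun x hx h =>
    hx ⟨(hK h).1, (hK h).2.trans_lt hBL⟩
  have hφ0 : ∀ x, x ∉ Set.Ioo A L → φ x = 0 := fun x hx =>
    image_eq_zero_of_notMem_tsupport (hout x hx)
  have hφ1 : ∀ x, x ∉ Set.Ioo A L → deriv φ x = 0 := fun x hx =>
    image_eq_zero_of_notMem_tsupport fun h => hout x hx (tsupport_deriv_subset h)
  have hAL : A ≤ L := (hAB.trans hBL).le
  rw [setIntegral_Iio_eq_intervalIntegral hAL fun x hx => by rw [hφ1 x hx, mul_zero],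
    setIntegral_Iio_eq_intervalIntegral hAL fun x hx => by rw [hφ0 x hx, mul_zero]]
  -- The primitive of a locally integrable function is only absolutely continuous, which suffices to
  -- integrate by parts.
  have h1 := (intervalIntegrable_of_locallyIntegrable hG A
    L).absolutelyContinuousOnInterval_intervalIntegral (c := L) Set.right_mem_uIcc
  have h2 : AbsolutelyContinuousOnInterval φ A L :=
    ContDiffOn.absolutelyContinuousOnInterval ((hφ.of_le (by exact_mod_cast le_top)).contDiffOn)
  rw [h1.integral_mul_deriv_eq_deriv_mul h2, hφ0 L (by simp), hφ0 A (by simp), mul_zero, mul_zero,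
    sub_zero, zero_sub]
  congr 1
  refine intervalIntegral.integral_congr_ae ?_
  filter_upwards [LocallyIntegrable.ae_hasDerivAt_integral hG] with x hx _
  rw [(hx L).deriv]

/-- A function whose weak derivative on a half-line vanishes is constant. -/
theorem exists_ae_eq_const {L : ℝ} {g : ℝ → ℝ} (hg : LocallyIntegrableOn g (Set.Iio L))
    (h : ∀ φ : ℝ → ℝ, ContDiff ℝ (⊤ : ℕ∞) φ → HasCompactSupport φ → tsupport φ ⊆ Set.Iio L →
      ∫ x in Set.Iio L, g x * deriv φ x = 0) :
    ∃ c : ℝ, ∀ᵐ x, x ∈ Set.Iio L → g x = c := by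
  have hint : ∀ φ : ℝ → ℝ, ContDiff ℝ (⊤ : ℕ∞) φ → HasCompactSupport φ → tsupport φ ⊆ Set.Iio L →
      ∀ f : ℝ → ℝ, LocallyIntegrableOn f (Set.Iio L) → Integrable (fun x => f x * φ x) := by
    intro φ hφ hc hs f hf
    have h1 : IntegrableOn (fun x => f x * φ x) (tsupport φ) :=
      (hf.integrableOn_compact_subset hs hc).mul_continuousOn hφ.continuous.continuousOn hc
    exact (integrableOn_iff_integrable_of_support_subset (fun x hx => subset_tsupport φ
      (fun h => hx (by simp [h])))).1 h1
  have hzero : ∀ φ : ℝ → ℝ, tsupport φ ⊆ Set.Iio L → ∀ x, L ≤ x → φ x = 0 := fun φ hs x hx =>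
    image_eq_zero_of_notMem_tsupport fun h => (lt_of_lt_of_le (hs h) hx).false
  let b : ContDiffBump (L - 2 : ℝ) := ⟨1 / 2, 1, by norm_num, by norm_num⟩
  set φ₀ : ℝ → ℝ := b.normed volume with hφ₀
  have hφ₀s : ContDiff ℝ (⊤ : ℕ∞) φ₀ := b.contDiff_normed
  have hφ₀c : HasCompactSupport φ₀ := b.hasCompactSupport_normed
  have hφ₀t : tsupport φ₀ ⊆ Set.Iio L := by
    rw [hφ₀, b.tsupport_normed_eq, Real.closedBall_eq_Icc]
    intro x hx
    have : x ≤ L - 2 + 1 := hx.2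
    show x < L
    linarith
  have hφ₀i : ∫ x, φ₀ x = 1 := b.integral_normed
  set c := ∫ x, g x * φ₀ x with hcdef
  refine ⟨c, ?_⟩
  have key : ∀ᵐ x, x ∈ Set.Iio L → (fun x => g x - c) x = 0 := by
    refine isOpen_Iio.ae_eq_zero_of_integral_contDiff_smul_eq_zero
      (hg.sub ((locallyIntegrable_const c).locallyIntegrableOn _)) fun φ hφ hc hs => ?_
    set s := ∫ x, φ x with hs_def
    -- A test function is the derivative of another one exactly when its mean vanishes. Subtracting
    -- `s φ₀` removes the mean of `φ`, and the hypothesis applied to the primitive of `η` gives `∫ g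
    -- φ = c ∫ φ`.
    set η : ℝ → ℝ := fun x => φ x - s * φ₀ x with hη
    have hηc : ContDiff ℝ (⊤ : ℕ∞) η := hφ.sub (contDiff_const.mul hφ₀s)
    have hφi : Integrable φ := hφ.continuous.integrable_of_hasCompactSupport hc
    have hφ₀int : Integrable φ₀ := hφ₀s.continuous.integrable_of_hasCompactSupport hφ₀c
    have hηi : Integrable η := hφi.sub (hφ₀int.const_mul s)
    have hη0 : ∫ x, η x = 0 := by
      rw [hη, integral_sub hφi (hφ₀int.const_mul s), integral_const_mul, hφ₀i, mul_one, sub_self]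
    obtain ⟨A, B, hAB, hBL, hK⟩ := exists_Ioc_of_compact_subset_Iio (IsCompact.union hc hφ₀c)
      (Set.union_subset hs hφ₀t)
    have hηout : ∀ x, x ∉ Set.Ioc A B → η x = 0 := by
      intro x hx
      simp only [hη]
      rw [image_eq_zero_of_notMem_tsupport fun h => hx (hK (Or.inl h)),
        image_eq_zero_of_notMem_tsupport fun h => hx (hK (Or.inr h)), mul_zero, sub_zero]
    set ψ : ℝ → ℝ := fun x => ∫ t in A..x, η t with hψ
    have hψd : ∀ x, HasDerivAt ψ (η x) x := fun x =>
      intervalIntegral.integral_hasDerivAt_right (hηc.continuous.intervalIntegrable _ _)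
        (hηc.continuous.stronglyMeasurableAtFilter _ _) hηc.continuous.continuousAt
    have hψ' : deriv ψ = η := funext fun x => (hψd x).deriv
    have hψc : ContDiff ℝ (⊤ : ℕ∞) ψ :=
      contDiff_infty_iff_deriv.2 ⟨fun x => (hψd x).differentiableAt, by rw [hψ']; exact hηc⟩
    have hψout : ∀ x, x ∉ Set.Icc A B → ψ x = 0 := by
      intro x hx
      rcases lt_or_ge x A with h1 | h1
      · simp only [hψ]
        rw [intervalIntegral.integral_of_ge h1.le, neg_eq_zero]
        exact setIntegral_eq_zero_of_forall_eq_zero fun t ht =>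
          hηout t fun h => (h.1.trans_le ht.2).false
      · have h2 : B < x := not_le.1 fun h => hx ⟨h1, h⟩
        simp only [hψ]
        rw [intervalIntegral.integral_of_le h1, ← hη0]
        exact setIntegral_eq_integral_of_forall_compl_eq_zero fun t ht =>
          hηout t fun h => ht ⟨h.1, h.2.trans h2.le⟩
    have hψt : tsupport ψ ⊆ Set.Icc A B := closure_minimal
      (fun x hx => by by_contra h; exact hx (hψout x h)) isClosed_Icc
    have hψcs : HasCompactSupport ψ := HasCompactSupport.intro isCompact_Icc hψout
    have h1 := h ψ hψc hψcs (hψt.trans fun x hx => hx.2.trans_lt hBL)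
    rw [hψ', setIntegral_Iio_eq_integral fun x hx => by
      simp only [hη]; rw [hzero φ hs x hx, hzero φ₀ hφ₀t x hx]; ring] at h1
    have i1 := hint φ hφ hc hs g hg
    have i2 := hint φ₀ hφ₀s hφ₀c hφ₀t g hg
    have e1 : ∀ x, g x * η x = g x * φ x - s * (g x * φ₀ x) := fun x => by
      simp only [hη]; ring
    simp only [e1] at h1
    rw [integral_sub i1 (i2.const_mul s), integral_const_mul, ← hcdef] at h1
    have e2 : ∀ x, φ x • (g x - c) = g x * φ x - c * φ x := fun x => by
      rw [smul_eq_mul]; ring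
    simp only [e2]
    rw [integral_sub i1 (hφi.const_mul c), integral_const_mul, ← hs_def]
    linarith
  filter_upwards [key] with x hx hxL
  linarith [hx hxL]

/-- A function with weak derivative `G` on a half-line is a primitive of `G`. -/
theorem exists_ae_eq_primitive {L : ℝ} {v G : ℝ → ℝ} (hv : LocallyIntegrableOn v (Set.Iio L))
    (hG : LocallyIntegrable G)
    (h : ∀ φ : ℝ → ℝ, ContDiff ℝ (⊤ : ℕ∞) φ → HasCompactSupport φ → tsupport φ ⊆ Set.Iio L →
      ∫ x in Set.Iio L, v x * deriv φ x = -∫ x in Set.Iio L, G x * φ x) :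
    ∃ c : ℝ, ∀ᵐ x, x ∈ Set.Iio L → v x = c + ∫ t in L..x, G t := by
  have hVc : Continuous fun x => ∫ t in L..x, G t :=
    intervalIntegral.continuous_primitive (intervalIntegrable_of_locallyIntegrable hG) L
  have hVl : LocallyIntegrableOn (fun x => ∫ t in L..x, G t) (Set.Iio L) :=
    hVc.locallyIntegrable.locallyIntegrableOn _
  obtain ⟨c, hc⟩ := exists_ae_eq_const (hv.sub hVl) fun φ hφ hφc hφs => by
    have hd : Continuous (deriv φ) := (hφ.continuous_deriv (by exact_mod_cast le_top))
    have hint : ∀ f : ℝ → ℝ, LocallyIntegrableOn f (Set.Iio L) →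
        IntegrableOn (fun x => f x * deriv φ x) (Set.Iio L) := by
      intro f hf
      have h1 : IntegrableOn (fun x => f x * deriv φ x) (tsupport φ) :=
        (hf.integrableOn_compact_subset hφs hφc).mul_continuousOn hd.continuousOn hφc
      exact ((integrableOn_iff_integrable_of_support_subset (fun x hx => support_deriv_subset
        (fun h => hx (by simp [h])))).1 h1).integrableOn
    simp only [Pi.sub_apply, sub_mul]
    rw [integral_sub (hint v hv) (hint _ hVl), h φ hφ hφc hφs,
      integral_primitive_mul_deriv hG hφ hφc hφs, sub_self]
  refine ⟨c, ?_⟩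
  filter_upwards [hc] with x hx hxL
  have := hx hxL
  simp only [Pi.sub_apply] at this
  linarith

/-- Weak derivatives of orders `i` and `i + 1` are both defined against `u`; testing the former with
`φ'` links them directly. -/
theorem IsWeakDeriv.integral_mul_deriv {O : Set ℝ} {i : ℕ} {u v w : ℝ → ℝ}
    (hv : IsWeakDeriv O i u v) (hw : IsWeakDeriv O (i + 1) u w) {φ : ℝ → ℝ}
    (hφ : ContDiff ℝ (⊤ : ℕ∞) φ) (hc : HasCompactSupport φ) (hs : tsupport φ ⊆ O) :
    ∫ x in O, v x * deriv φ x = -∫ x in O, w x * φ x := by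
  have h1 := hv.2.2 (deriv φ) (contDiff_infty_iff_deriv.1 hφ).2 hc.deriv
    (tsupport_deriv_subset.trans hs)
  have h2 := hw.2.2 φ hφ hc hs
  rw [iteratedDeriv_succ'] at h2
  rw [h1, pow_succ, mul_assoc, neg_one_mul] at h2
  exact mul_left_cancel₀ (pow_ne_zero i (by norm_num)) h2

theorem MemH.isWeakDeriv {m : ℕ} {O : Set ℝ} {u : ℝ → ℝ} (hu : MemH m O u) {i : ℕ} (hi : i ≤ m) :
    IsWeakDeriv O i u (weakDeriv O i u) := by
  have h : ∃ v, IsWeakDeriv O i u v := by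
    obtain ⟨v, hv, -⟩ := hu.2 i hi
    exact ⟨v, hv⟩
  rw [weakDeriv, dif_pos h]
  exact h.choose_spec

theorem MemH.memLp_weakDeriv {m : ℕ} {O : Set ℝ} (hO : IsOpen O) {u : ℝ → ℝ} (hu : MemH m O u)
    {i : ℕ} (hi : i ≤ m) : MemLp (weakDeriv O i u) 2 (volume.restrict O) := by
  obtain ⟨v, hv, hv2⟩ := hu.2 i hi
  exact (memLp_congr_ae (hv.ae_eq hO (hu.isWeakDeriv hi))).1 hv2

theorem MemH.weakDeriv_zero {m : ℕ} {O : Set ℝ} (hO : IsOpen O) {u : ℝ → ℝ} (hu : MemH m O u) :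
    weakDeriv O 0 u =ᵐ[volume.restrict O] u := by
  have h := hu.isWeakDeriv (Nat.zero_le m)
  exact h.ae_eq hO ⟨h.1, h.1, fun φ _ _ _ => by simp⟩

theorem MemH.integral_sq_le {m : ℕ} {O : Set ℝ} {u : ℝ → ℝ} {i : ℕ} (hi : i ≤ m) :
    ∫ x in O, (weakDeriv O i u x) ^ 2 ≤ (normH m O u) ^ 2 := by
  have h0 : ∀ i, 0 ≤ ∫ x in O, (weakDeriv O i u x) ^ 2 := fun i =>
    integral_nonneg fun x => sq_nonneg _
  rw [normH, Real.sq_sqrt (Finset.sum_nonneg fun i _ => h0 i)]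
  exact Finset.single_le_sum (f := fun i => ∫ x in O, (weakDeriv O i u x) ^ 2)
    (fun i _ => h0 i) (Finset.mem_range.2 (by omega))

/-! ### Regular representatives and extension past the boundary -/

/-- `U 0` is of class `C^q` with successive derivatives `U 1, …, U q`, and `U q` is a primitive of
the locally integrable function `f`. -/
structure IsDerivChain (q : ℕ) (U : ℕ → ℝ → ℝ) (f : ℝ → ℝ) : Prop where
  continuous : ∀ m ≤ q, Continuous (U m)
  hasDerivAt : ∀ m < q, ∀ x, HasDerivAt (U m) (U (m + 1) x) x
  locallyIntegrable : LocallyIntegrable f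
  sub_eq : ∀ x y, U q y - U q x = ∫ t in x..y, f t

theorem IsDerivChain.tail {q : ℕ} {U : ℕ → ℝ → ℝ} {f : ℝ → ℝ} (h : IsDerivChain (q + 1) U f) :
    IsDerivChain q (fun m => U (m + 1)) f where
  continuous m hm := h.continuous (m + 1) (by omega)
  hasDerivAt m hm := h.hasDerivAt (m + 1) (by omega)
  locallyIntegrable := h.locallyIntegrable
  sub_eq := h.sub_eq

/-- Functions linked by weak differentiation on a half-line extend to a regular chain on `ℝ`. -/
theorem exists_derivChain_of_weak {L : ℝ} {f : ℝ → ℝ} (hf : LocallyIntegrable f) (q : ℕ) :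
    ∀ w : ℕ → ℝ → ℝ, (∀ i ≤ q, LocallyIntegrableOn (w i) (Set.Iio L)) →
      (∀ i ≤ q, ∀ φ : ℝ → ℝ, ContDiff ℝ (⊤ : ℕ∞) φ → HasCompactSupport φ →
        tsupport φ ⊆ Set.Iio L →
        ∫ x in Set.Iio L, w i x * deriv φ x = -∫ x in Set.Iio L, w (i + 1) x * φ x) →
      (∀ᵐ x, x ∈ Set.Iio L → w (q + 1) x = f x) →
      ∃ U, IsDerivChain q U f ∧ ∀ i ≤ q, ∀ᵐ x, x ∈ Set.Iio L → w i x = U i x := by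
  have hcongr : ∀ g g' φ : ℝ → ℝ, (∀ᵐ x, x ∈ Set.Iio L → g x = g' x) →
      ∫ x in Set.Iio L, g x * φ x = ∫ x in Set.Iio L, g' x * φ x := fun g g' φ h =>
    setIntegral_congr_ae measurableSet_Iio (by
      filter_upwards [h] with x hx hxL
      rw [hx hxL])
  induction q with
  | zero =>
    intro w hw hd hf'
    obtain ⟨c, hc⟩ := exists_ae_eq_primitive (hw 0 le_rfl) hf fun φ h1 h2 h3 => by
      rw [hd 0 le_rfl φ h1 h2 h3, hcongr _ _ φ hf']
    refine ⟨fun _ x => c + ∫ t in L..x, f t, ⟨fun _ _ => ?_, fun m hm => absurd hm (by omega), hf,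
      fun x y => ?_⟩, fun i hi => ?_⟩
    · exact continuous_const.add (intervalIntegral.continuous_primitive
        (intervalIntegrable_of_locallyIntegrable hf) L)
    · rw [add_sub_add_left_eq_sub]
      exact intervalIntegral.integral_interval_sub_left
        (intervalIntegrable_of_locallyIntegrable hf _ _)
        (intervalIntegrable_of_locallyIntegrable hf _ _)
    · obtain rfl : i = 0 := by omega
      exact hc
  | succ q ih =>
    intro w hw hd hf'
    obtain ⟨U, hU, hUw⟩ := ih (fun i => w (i + 1)) (fun i hi => hw (i + 1) (by omega))
      (fun i hi => hd (i + 1) (by omega)) hf'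
    have hU0 : Continuous (U 0) := hU.continuous 0 (Nat.zero_le q)
    obtain ⟨c, hc⟩ := exists_ae_eq_primitive (hw 0 (Nat.zero_le _)) hU0.locallyIntegrable
      fun φ h1 h2 h3 => by
        rw [hd 0 (Nat.zero_le _) φ h1 h2 h3, hcongr _ _ φ (hUw 0 (Nat.zero_le q))]
    set V : ℝ → ℝ := fun x => c + ∫ t in L..x, U 0 t with hV
    have hVd : ∀ x, HasDerivAt V (U 0 x) x := fun x =>
      (intervalIntegral.integral_hasDerivAt_right (hU0.intervalIntegrable _ _)
        (hU0.stronglyMeasurableAtFilter _ _) hU0.continuousAt).const_add c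
    refine ⟨fun m => Nat.casesOn m V U, ⟨fun m hm => ?_, fun m hm x => ?_, hf, hU.sub_eq⟩,
      fun i hi => ?_⟩
    · cases m with
      | zero => exact continuous_iff_continuousAt.2 fun x => (hVd x).continuousAt
      | succ m => exact hU.continuous m (by omega)
    · cases m with
      | zero => exact hVd x
      | succ m => exact hU.hasDerivAt m (by omega) x
    · cases i with
      | zero => exact hc
      | succ i => exact hUw i (by omega)

theorem sq_integral_le {a b : ℝ} (hab : a ≤ b) {g : ℝ → ℝ} (hg : IntervalIntegrable g volume a b)
    (hg2 : IntervalIntegrable (fun x => (g x) ^ 2) volume a b) :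
    (∫ x in a..b, g x) ^ 2 ≤ (b - a) * ∫ x in a..b, (g x) ^ 2 := by
  rcases hab.eq_or_lt with rfl | hlt
  · simp
  set I := ∫ x in a..b, g x with hI
  -- Cauchy–Schwarz, from the nonnegative variance of `g` about its mean.
  have h0 : 0 ≤ ∫ x in a..b, ((b - a) * g x - I) ^ 2 :=
    intervalIntegral.integral_nonneg hab fun x _ => sq_nonneg _
  have e : ∀ x, ((b - a) * g x - I) ^ 2 =
      (b - a) ^ 2 * (g x) ^ 2 - 2 * (b - a) * I * g x + I ^ 2 := fun x => by ring
  simp only [e] at h0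
  rw [intervalIntegral.integral_add ((hg2.const_mul _).sub (hg.const_mul _))
    intervalIntegrable_const, intervalIntegral.integral_sub (hg2.const_mul _) (hg.const_mul _),
    intervalIntegral.integral_const_mul, intervalIntegral.integral_const_mul,
    intervalIntegral.integral_const, ← hI, smul_eq_mul] at h0
  have h1 : 0 ≤ (b - a) * ((b - a) * (∫ x in a..b, (g x) ^ 2) - I ^ 2) := by linarith
  have := nonneg_of_mul_nonneg_right h1 (sub_pos.2 hlt)
  linarith

theorem intervalIntegral_abs_le {a b : ℝ} (hab : a ≤ b) {O : Set ℝ} (hO : Set.Ioc a b ⊆ O)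
    {g : ℝ → ℝ} (hg : IntervalIntegrable g volume a b)
    (hg2 : IntegrableOn (fun x => (g x) ^ 2) O) :
    ∫ x in a..b, |g x| ≤ Real.sqrt ((b - a) * ∫ x in O, (g x) ^ 2) := by
  have hle : ∫ x in a..b, (g x) ^ 2 ≤ ∫ x in O, (g x) ^ 2 := by
    rw [intervalIntegral.integral_of_le hab]
    exact setIntegral_mono_set hg2 (Filter.Eventually.of_forall fun x => sq_nonneg (g x))
      hO.eventuallyLE
  have h2 : IntervalIntegrable (fun x => |g x| ^ 2) volume a b := by
    simp only [sq_abs]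
    exact (intervalIntegrable_iff_integrableOn_Ioc_of_le hab).2 (hg2.mono_set hO)
  refine Real.le_sqrt_of_sq_le ((sq_integral_le hab hg.abs h2).trans ?_)
  simp only [sq_abs]
  exact mul_le_mul_of_nonneg_left hle (by linarith)

/-- Extension of a Sobolev function on a half-line, with bounds on its highest derivatives. -/
theorem exists_extension {L : ℝ} {q : ℕ} {u : ℝ → ℝ} (hu : MemH (q + 1) (Set.Iio L) u) :
    ∃ (U : ℕ → ℝ → ℝ) (f : ℝ → ℝ), IsDerivChain q U f ∧
      (∀ᵐ x, x ∈ Set.Iio L → u x = U 0 x) ∧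
      Integrable (fun x => (f x) ^ 2) ∧
      ∫ x, (f x) ^ 2 ≤ (normH (q + 1) (Set.Iio L) u) ^ 2 ∧
      ∀ x, |U q x| ≤ 2 * normH (q + 1) (Set.Iio L) u := by
  set w : ℕ → ℝ → ℝ := fun i => weakDeriv (Set.Iio L) i u with hw
  -- Extending the top derivative by zero makes `U q` constant beyond `L`. The lower `U m` may grow
  -- there, but only `f` and `U q` enter the estimates.
  set f : ℝ → ℝ := (Set.Iio L).indicator (w (q + 1)) with hf
  set H := normH (q + 1) (Set.Iio L) u with hH
  have hH0 : 0 ≤ H := Real.sqrt_nonneg _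
  have hfL : MemLp f 2 volume :=
    (memLp_indicator_iff_restrict measurableSet_Iio).2 (hu.memLp_weakDeriv isOpen_Iio le_rfl)
  have hfl : LocallyIntegrable f := hfL.locallyIntegrable (by norm_num)
  obtain ⟨U, hU, hUw⟩ := exists_derivChain_of_weak (L := L) hfl q w
    (fun i hi => (hu.isWeakDeriv (by omega)).2.1)
    (fun i hi φ h1 h2 h3 => (hu.isWeakDeriv (by omega)).integral_mul_deriv
      (hu.isWeakDeriv (by omega)) h1 h2 h3)
    (Filter.Eventually.of_forall fun x hx => (Set.indicator_of_mem hx _).symm)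
  have hf2 : ∫ x, (f x) ^ 2 ≤ H ^ 2 := by
    refine le_trans (le_of_eq ?_) (MemH.integral_sq_le (i := q + 1) le_rfl)
    rw [← integral_indicator measurableSet_Iio]
    refine integral_congr_ae (Filter.Eventually.of_forall fun x => ?_)
    by_cases hx : x ∈ Set.Iio L <;> simp [hf, hx, hw]
  have hU2 : IntegrableOn (fun x => (U q x) ^ 2) (Set.Iio L) ∧
      ∫ x in Set.Iio L, (U q x) ^ 2 ≤ H ^ 2 := by
    have hae : w q =ᵐ[volume.restrict (Set.Iio L)] U q :=
      (ae_restrict_iff' measurableSet_Iio).2 (hUw q le_rfl)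
    have h1 : MemLp (U q) 2 (volume.restrict (Set.Iio L)) :=
      (memLp_congr_ae hae).1 (hu.memLp_weakDeriv isOpen_Iio (by omega))
    refine ⟨h1.integrable_sq, le_trans (le_of_eq ?_) (MemH.integral_sq_le (i := q) (by omega))⟩
    refine integral_congr_ae ?_
    filter_upwards [hae] with x hx
    rw [← hx]
  -- One-dimensional Sobolev inequality on `[x - 1, x]`: `|U q x| ≤ |U q y| + ∫ |f|`, averaged over
  -- `y`; each part contributes `H`.
  have hbound : ∀ x ≤ L, |U q x| ≤ 2 * H := by
    intro x hx
    have hUc : Continuous (U q) := hU.continuous q le_rfl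
    have hii := intervalIntegrable_of_locallyIntegrable hfl
    have a1 : ∫ t in (x - 1)..x, |f t| ≤ H := by
      have h := intervalIntegral_abs_le (by linarith : x - 1 ≤ x) (Set.subset_univ _) (hii _ _)
        hfL.integrable_sq.integrableOn
      rw [sub_sub_cancel, one_mul, setIntegral_univ] at h
      exact h.trans ((Real.sqrt_le_sqrt hf2).trans_eq (Real.sqrt_sq hH0))
    have a2 : ∫ t in (x - 1)..x, |U q t| ≤ H := by
      have hcl : IntegrableOn (fun y => (U q y) ^ 2) (Set.Iic L) :=
        hU2.1.congr_set_ae Iio_ae_eq_Iic.symm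
      have h := intervalIntegral_abs_le (by linarith : x - 1 ≤ x) (O := Set.Iic L)
        (fun y hy => hy.2.trans hx) (hUc.intervalIntegrable _ _) hcl
      rw [sub_sub_cancel, one_mul, integral_Iic_eq_integral_Iio] at h
      exact h.trans ((Real.sqrt_le_sqrt hU2.2).trans_eq (Real.sqrt_sq hH0))
    have a3 : ∀ y ∈ Set.Icc (x - 1) x, |U q x| ≤ |U q y| + H := by
      intro y hy
      have h1 : |U q x - U q y| ≤ H := by
        rw [hU.sub_eq]
        refine le_trans ?_ a1
        rw [← Real.norm_eq_abs]
        refine (intervalIntegral.norm_integral_le_abs_integral_norm).trans ?_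
        refine (intervalIntegral.abs_integral_mono_interval (c := x - 1) (d := x) ?_
          (Filter.Eventually.of_forall fun t => norm_nonneg _) (hii _ _).norm).trans_eq ?_
        · rw [Set.uIoc_of_le hy.2, Set.uIoc_of_le (by linarith)]
          exact Set.Ioc_subset_Ioc_left hy.1
        · exact abs_of_nonneg (intervalIntegral.integral_nonneg (by linarith)
            fun t _ => norm_nonneg _)
      have h2 := abs_sub_abs_le_abs_sub (U q x) (U q y)
      linarith
    have a4 := intervalIntegral.integral_mono_on (μ := volume) (by linarith : x - 1 ≤ x)
      intervalIntegrable_const ((hUc.abs.add continuous_const).intervalIntegrable _ _) a3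
    simp only [Pi.add_apply] at a4
    rw [intervalIntegral.integral_const, sub_sub_cancel, one_smul, intervalIntegral.integral_add
      (hUc.abs.intervalIntegrable _ _) intervalIntegrable_const, intervalIntegral.integral_const,
      sub_sub_cancel, one_smul] at a4
    linarith
  refine ⟨U, f, hU, ?_, hfL.integrable_sq, hf2, fun x => ?_⟩
  · filter_upwards [hUw 0 (Nat.zero_le q), (ae_restrict_iff' measurableSet_Iio).1
      (hu.weakDeriv_zero isOpen_Iio)] with x h1 h2 hx
    rw [← h1 hx, ← h2 hx]
  · rcases le_total x L with hx | hx
    · exact hbound x hx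
    · have h1 := hU.sub_eq L x
      rw [intervalIntegral.integral_of_le hx, setIntegral_eq_zero_of_forall_eq_zero fun t ht =>
        Set.indicator_of_notMem (fun h => (ht.1.trans h).false) _] at h1
      rw [sub_eq_zero.1 h1]
      exact hbound L le_rfl

/-! ### Taylor remainders, backward differences and cell averages -/

theorem hasDerivAt_sum_pow_div_factorial (c : ℕ → ℝ) (q : ℕ) (s : ℝ) :
    HasDerivAt (fun s => ∑ m ∈ Finset.range (q + 2), c m * s ^ m / (m.factorial : ℝ))
      (∑ m ∈ Finset.range (q + 1), c (m + 1) * s ^ m / (m.factorial : ℝ)) s := by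
  simp only [Finset.sum_range_succ' _ (q + 1)]
  have h := HasDerivAt.fun_sum (u := Finset.range (q + 1)) (x := s)
    (A := fun m s => c (m + 1) * s ^ (m + 1) / ((m + 1).factorial : ℝ))
    (A' := fun m => c (m + 1) * s ^ m / (m.factorial : ℝ)) fun m _ => by
      refine (((hasDerivAt_pow (m + 1) s).const_mul (c (m + 1))).div_const
        ((m + 1).factorial : ℝ)).congr_deriv ?_
      rw [Nat.factorial_succ, Nat.add_sub_cancel]
      have : (m.factorial : ℝ) ≠ 0 := by exact_mod_cast m.factorial_ne_zero
      push_cast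
      field_simp
  simpa using h.add_const (c 0)

/-- Taylor's formula, with a bound on the remainder by the integral of the last derivative. -/
theorem IsDerivChain.abs_sub_taylor_le {q : ℕ} {U : ℕ → ℝ → ℝ} {f : ℝ → ℝ}
    (hU : IsDerivChain q U f) (z : ℝ) {H h : ℝ} (hh : |h| ≤ H) :
    |U 0 (z + h) - ∑ m ∈ Finset.range (q + 1), U m z * h ^ m / (m.factorial : ℝ)| ≤
      H ^ q * ∫ t in (z - H)..(z + H), |f t| := by
  have hH : 0 ≤ H := (abs_nonneg h).trans hh
  set B := ∫ t in (z - H)..(z + H), |f t| with hB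
  have hB0 : 0 ≤ B := intervalIntegral.integral_nonneg (by linarith) fun _ _ => abs_nonneg _
  induction q generalizing U h with
  | zero =>
    have h1 := hU.sub_eq z (z + h)
    simp only [zero_add, Finset.sum_range_one, pow_zero, mul_one, Nat.factorial_zero,
      Nat.cast_one, div_one, one_mul]
    rw [h1, ← Real.norm_eq_abs]
    refine (intervalIntegral.norm_integral_le_abs_integral_norm).trans ?_
    refine (intervalIntegral.abs_integral_mono_interval (c := z - H) (d := z + H) ?_
      (Filter.Eventually.of_forall fun t => norm_nonneg _)
      (intervalIntegrable_of_locallyIntegrable hU.locallyIntegrable _ _).norm).trans_eq ?_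
    · rw [abs_le] at hh
      rw [Set.uIoc_of_le (by linarith : z - H ≤ z + H)]
      rcases le_total 0 h with h0 | h0
      · rw [Set.uIoc_of_le (by linarith)]
        exact Set.Ioc_subset_Ioc (by linarith) (by linarith)
      · rw [Set.uIoc_of_ge (by linarith)]
        exact Set.Ioc_subset_Ioc (by linarith) (by linarith)
    · exact abs_of_nonneg hB0
  | succ q ih =>
    set g : ℝ → ℝ := fun s => U 0 (z + s) -
      ∑ m ∈ Finset.range (q + 2), U m z * s ^ m / (m.factorial : ℝ) with hg
    have hgd : ∀ s, HasDerivAt g (U 1 (z + s) -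
        ∑ m ∈ Finset.range (q + 1), U (m + 1) z * s ^ m / (m.factorial : ℝ)) s := fun s =>
      ((hU.hasDerivAt 0 (by omega) (z + s)).comp_const_add z s).sub
        (hasDerivAt_sum_pow_div_factorial (fun m => U m z) q s)
    have hg0 : g 0 = 0 := by
      simp only [hg]
      rw [Finset.sum_range_succ']
      simp
    -- The derivative of the remainder is the remainder for the chain starting at `U 1`, bounded by
    -- induction uniformly on `[-H, H]`; the mean value inequality adds a factor `H`.
    have h1 := (convex_Icc (-H) H).norm_image_sub_le_of_norm_hasDerivWithin_le (f := g)
      (fun s _ => (hgd s).hasDerivWithinAt) (C := H ^ q * B)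
      (fun s hs => by
        rw [Real.norm_eq_abs]
        exact ih hU.tail (abs_le.2 hs)) (x := 0) (y := h) ⟨by linarith, hH⟩ (abs_le.1 hh)
    rw [hg0, sub_zero, sub_zero, Real.norm_eq_abs, Real.norm_eq_abs] at h1
    refine h1.trans ?_
    calc H ^ q * B * |h| ≤ H ^ q * B * H := mul_le_mul_of_nonneg_left hh (by positivity)
      _ = H ^ (q + 1) * B := by ring

/-- The backward difference of step `h`. -/
def backDiff (h : ℝ) (g : ℝ → ℝ) (y : ℝ) : ℝ := g y - g (y - h)

theorem continuous_backDiff {g : ℝ → ℝ} (hg : Continuous g) (h : ℝ) :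
    Continuous (backDiff h g) :=
  hg.sub (hg.comp (continuous_id.sub continuous_const))

theorem abs_iterate_backDiff_le_of_bounded {g : ℝ → ℝ} {B : ℝ} (hg : ∀ x, |g x| ≤ B) (h : ℝ)
    (n : ℕ) : ∀ x, |(backDiff h)^[n] g x| ≤ 2 ^ n * B := by
  induction n with
  | zero => simpa using hg
  | succ n ih =>
    intro x
    rw [Function.iterate_succ_apply', pow_succ]
    refine (abs_sub _ _).trans ?_
    linarith [ih x, ih (x - h)]

/-- Differences commute with derivatives: `backDiff h (U m)` is again a chain, one step shorter, and
the mean value inequality at its top gains a factor `h`. -/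
theorem abs_iterate_backDiff_le (q : ℕ) : ∀ {U : ℕ → ℝ → ℝ} {B h : ℝ}, 0 ≤ h →
    (∀ m < q, ∀ x, HasDerivAt (U m) (U (m + 1) x) x) → (∀ x, |U q x| ≤ B) →
    ∀ x, |(backDiff h)^[q] (U 0) x| ≤ h ^ q * B := by
  induction q with
  | zero =>
    intro U B h _ _ hB x
    simpa using hB x
  | succ q ih =>
    intro U B h hh hd hB x
    have h1 : ∀ x, |backDiff h (U q) x| ≤ B * h := by
      intro x
      have := convex_univ.norm_image_sub_le_of_norm_hasDerivWithin_le (f := U q)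
        (fun s _ => (hd q (by omega) s).hasDerivWithinAt) (fun s _ => hB s)
        (Set.mem_univ (x - h)) (Set.mem_univ x)
      rwa [Real.norm_eq_abs, Real.norm_eq_abs, sub_sub_cancel, abs_of_nonneg hh] at this
    rw [Function.iterate_succ_apply]
    refine (ih (U := fun m => backDiff h (U m)) hh (fun m hm x => ?_) h1 x).trans_eq (by ring)
    exact (hd m (by omega) x).sub ((hd m (by omega) (x - h)).comp_sub_const x h)

theorem cellAverage_comp_add (dx : ℝ) (g : ℝ → ℝ) (j l : ℤ) :
    cellAverage dx (fun y => g (y + l * dx)) j = cellAverage dx g (j + l) := by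
  rw [cellAverage, cellAverage, intervalIntegral.integral_comp_add_right]
  congr 2 <;> push_cast <;> ring

theorem cellAverage_sub {dx : ℝ} {g h : ℝ → ℝ} (hg : Continuous g) (hh : Continuous h) (j : ℤ) :
    cellAverage dx (fun y => g y - h y) j = cellAverage dx g j - cellAverage dx h j := by
  rw [cellAverage, cellAverage, cellAverage, intervalIntegral.integral_sub
    (hg.intervalIntegrable _ _) (hh.intervalIntegrable _ _), mul_sub]

theorem abs_cellAverage_le {dx : ℝ} (hdx : 0 < dx) {g : ℝ → ℝ} {j : ℤ} {B : ℝ}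
    (hB : ∀ y, ((j : ℝ) - 1) * dx ≤ y → y ≤ j * dx → |g y| ≤ B) : |cellAverage dx g j| ≤ B := by
  have hle : ((j : ℝ) - 1) * dx ≤ j * dx := by linarith
  have h := intervalIntegral.norm_integral_le_of_norm_le_const (a := ((j : ℝ) - 1) * dx)
    (b := j * dx) (f := g) (C := B) fun y hy => by
      rw [Set.uIoc_of_le hle] at hy
      exact hB y hy.1.le hy.2
  rw [show (j : ℝ) * dx - ((j : ℝ) - 1) * dx = dx by ring, abs_of_pos hdx, Real.norm_eq_abs] at h
  rw [cellAverage, abs_mul, abs_of_pos (by positivity), one_div, inv_mul_le_iff₀ hdx]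
  linarith

theorem iterate_Dminus_cellAverage {dx : ℝ} (n : ℕ) : ∀ {g : ℝ → ℝ}, Continuous g →
    Dminus^[n] (cellAverage dx g) = cellAverage dx ((backDiff dx)^[n] g) := by
  induction n with
  | zero => intro g _; rfl
  | succ n ih =>
    intro g hg
    rw [Function.iterate_succ_apply, Function.iterate_succ_apply,
      ← ih (continuous_backDiff hg dx)]
    congr 1
    funext j
    have h1 := cellAverage_comp_add dx g j (-1)
    have h2 := cellAverage_sub (dx := dx) hg (hg.comp (continuous_id.sub (continuous_const (y := dx)))) j
    rw [Dminus, sub_eq_add_neg j 1, ← h1]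
    simp only [Int.cast_neg, Int.cast_one, neg_one_mul, ← sub_eq_add_neg]
    exact h2.symm

theorem stencil_cellAverage {r p : ℕ} {α : ℤ → ℝ} {dx : ℝ} {g : ℝ → ℝ} (hg : Continuous g)
    (j : ℤ) :
    stencil r p α (cellAverage dx g) j =
      cellAverage dx (fun y => ∑ l ∈ Finset.Icc (-(r : ℤ)) (p : ℤ), α l * g (y + l * dx)) j := by
  rw [stencil, cellAverage, intervalIntegral.integral_finsetSum, Finset.mul_sum]
  · refine Finset.sum_congr rfl fun l _ => ?_
    rw [intervalIntegral.integral_const_mul, mul_left_comm, ← cellAverage_comp_add, cellAverage]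
  · intro l _
    exact (continuous_const.mul (hg.comp (continuous_id.add continuous_const))).intervalIntegrable
      _ _

/-! ### Consistency of the scheme -/

/-- Pointwise consistency estimate. -/
theorem abs_consistency_le {a lam : ℝ} {k r p : ℕ} {α : ℤ → ℝ} (hα : SchemeAssumption a lam k r p α)
    {q : ℕ} (hq : q ≤ k) {U : ℕ → ℝ → ℝ} {f : ℝ → ℝ} (hU : IsDerivChain q U f) {dx : ℝ}
    (hdx : 0 ≤ dx) {κ : ℕ} (hr : r ≤ κ) (hp : p ≤ κ) (hκ : |lam * a| ≤ κ) (y : ℝ) :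
    |(∑ l ∈ Finset.Icc (-(r : ℤ)) (p : ℤ), α l * U 0 (y + l * dx)) - U 0 (y - lam * a * dx)| ≤
      ((∑ l ∈ Finset.Icc (-(r : ℤ)) (p : ℤ), |α l|) + 1) *
        ((κ * dx) ^ q * ∫ t in (y - κ * dx)..(y + κ * dx), |f t|) := by
  set I := Finset.Icc (-(r : ℤ)) (p : ℤ) with hI
  set E := (κ * dx) ^ q * ∫ t in (y - κ * dx)..(y + κ * dx), |f t| with hE
  set P : ℝ → ℝ := fun h => ∑ m ∈ Finset.range (q + 1), U m y * h ^ m / (m.factorial : ℝ) with hP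
  have hl : ∀ l ∈ I, |U 0 (y + l * dx) - P (l * dx)| ≤ E := fun l hl => by
    refine hU.abs_sub_taylor_le y ?_
    rw [abs_mul, abs_of_nonneg hdx]
    refine mul_le_mul_of_nonneg_right ?_ hdx
    rw [hI, Finset.mem_Icc] at hl
    rw [abs_le]
    constructor
    · have : -(κ : ℤ) ≤ l := by omega
      exact_mod_cast this
    · have : l ≤ (κ : ℤ) := by omega
      exact_mod_cast this
  have ha : |U 0 (y - lam * a * dx) - P (-(lam * a * dx))| ≤ E := by
    rw [sub_eq_add_neg y]
    refine hU.abs_sub_taylor_le y ?_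
    rw [abs_neg, abs_mul, abs_of_nonneg hdx]
    exact mul_le_mul_of_nonneg_right hκ hdx
  -- The moment conditions up to order `k ≥ q` say that the scheme transports polynomials of degree
  -- at most `q` exactly; only Taylor remainders survive.
  have hcancel : ∑ l ∈ I, α l * P (l * dx) = P (-(lam * a * dx)) := by
    simp only [hP, Finset.mul_sum]
    rw [Finset.sum_comm]
    refine Finset.sum_congr rfl fun m hm => ?_
    have h1 := hα.consistent m (by have := Finset.mem_range.1 hm; omega)
    have h2 : (-(lam * a * dx)) ^ m = (-(lam * a)) ^ m * dx ^ m := by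
      rw [← mul_pow]
      congr 1
      ring
    rw [h2, ← h1, Finset.sum_mul, Finset.mul_sum, Finset.sum_div]
    refine Finset.sum_congr rfl fun l _ => ?_
    rw [mul_pow]
    ring
  have e : (∑ l ∈ I, α l * U 0 (y + l * dx)) - U 0 (y - lam * a * dx) =
      (∑ l ∈ I, α l * (U 0 (y + l * dx) - P (l * dx))) -
        (U 0 (y - lam * a * dx) - P (-(lam * a * dx))) := by
    simp only [mul_sub, Finset.sum_sub_distrib]
    rw [hcancel]
    ring
  rw [e]
  refine (abs_sub _ _).trans ?_
  rw [add_mul, one_mul]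
  refine add_le_add ((Finset.abs_sum_le_sum_abs _ _).trans ?_) ha
  rw [Finset.sum_mul]
  refine Finset.sum_le_sum fun l hlI => ?_
  rw [abs_mul]
  exact mul_le_mul_of_nonneg_left (hl l hlI) (abs_nonneg _)

theorem sum_integral_cells {g : ℝ → ℝ} (hg : Integrable g) (dx : ℝ) (m : ℤ) (n : ℕ) :
    ∑ i ∈ Finset.range n, ∫ y in (((m - i : ℤ) : ℝ) - 1) * dx..((m - i : ℤ) : ℝ) * dx, g y =
      ∫ y in ((m : ℝ) - n) * dx..(m : ℝ) * dx, g y := by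
  induction n with
  | zero => simp
  | succ n ih =>
    rw [Finset.sum_range_succ, ih, add_comm]
    have h := intervalIntegral.integral_add_adjacent_intervals
      (a := ((m : ℝ) - (n + 1 : ℕ)) * dx) (b := ((m : ℝ) - n) * dx) (c := (m : ℝ) * dx)
      (hg.intervalIntegrable) (hg.intervalIntegrable)
    rw [← h]
    push_cast
    congr 2
    ring

/-- Estimate of the consistency error in `ℓ²`. -/
theorem energy_consistency_le {a lam : ℝ} {k r p : ℕ} {α : ℤ → ℝ}
    (hα : SchemeAssumption a lam k r p α) {q : ℕ} (hq : q ≤ k) {U : ℕ → ℝ → ℝ} {f : ℝ → ℝ}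
    (hU : IsDerivChain q U f) (hf : Integrable fun x => (f x) ^ 2) {dx : ℝ}
    (hdx : 0 < dx) {κ : ℕ} (hr : r ≤ κ) (hp : p ≤ κ) (hκ : |lam * a| ≤ κ) (j₀ : ℤ)
    {F : ℤ → ℝ} (hF : ∀ j, F j = stencil r p α (cellAverage dx (U 0)) (j₀ + j) -
      cellAverage dx (fun y => U 0 (y - lam * a * dx)) (j₀ + j)) :
    FiniteEnergy F ∧ energy F ≤
      ((∑ l ∈ Finset.Icc (-(r : ℤ)) (p : ℤ), |α l|) + 1) ^ 2 * (κ : ℝ) ^ (2 * q) *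
        (2 * κ + 1) ^ 2 * dx ^ (2 * q + 1) * ∫ x, (f x) ^ 2 := by
  set S := (∑ l ∈ Finset.Icc (-(r : ℤ)) (p : ℤ), |α l|) + 1 with hS
  have hS0 : 0 ≤ S := add_nonneg (Finset.sum_nonneg fun _ _ => abs_nonneg _) zero_le_one
  have hU0 : Continuous (U 0) := hU.continuous 0 (Nat.zero_le q)
  have hfl := hU.locallyIntegrable
  set c : ℤ → ℝ := fun m => ∫ y in ((m : ℝ) - 1) * dx..(m : ℝ) * dx, (f y) ^ 2 with hc
  have hcells : ∀ (m : ℤ) (n : ℕ), ∑ i ∈ Finset.range n, c (m - i) ≤ ∫ x, (f x) ^ 2 := by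
    intro m n
    rw [sum_integral_cells hf, intervalIntegral.integral_of_le
      (mul_le_mul_of_nonneg_right (by linarith [(Nat.cast_nonneg n : (0 : ℝ) ≤ n)]) hdx.le)]
    exact setIntegral_le_integral hf (Filter.Eventually.of_forall fun x => sq_nonneg (f x))
  set D := S ^ 2 * (κ : ℝ) ^ (2 * q) * (2 * κ + 1) * dx ^ (2 * q + 1) with hD
  have hD0 : 0 ≤ D := by positivity
  -- For `y` in a cell, `[y - κ dx, y + κ dx]` lies in the `2 κ + 1` cells around it. Cauchy–Schwarz
  -- on this window gives the extra power of `dx`.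
  have hpt : ∀ j, (F j) ^ 2 ≤ D * ∑ i ∈ Finset.range (2 * κ + 1), c (j₀ + j + κ - i) := by
    intro j
    set J := j₀ + j with hJ
    set X := ∫ t in ((((J + κ : ℤ) : ℝ) - (2 * κ + 1 : ℕ)) * dx)..(((J + κ : ℤ) : ℝ) * dx), |f t| with hX
    have hle : (((J + κ : ℤ) : ℝ) - (2 * κ + 1 : ℕ)) * dx ≤ ((J + κ : ℤ) : ℝ) * dx :=
      mul_le_mul_of_nonneg_right (by linarith [(Nat.cast_nonneg (2 * κ + 1) :
        (0 : ℝ) ≤ ((2 * κ + 1 : ℕ) : ℝ))]) hdx.le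
    have hX0 : 0 ≤ X := intervalIntegral.integral_nonneg hle fun _ _ => abs_nonneg _
    have h1 : |F j| ≤ S * ((κ * dx) ^ q * X) := by
      have hcont : Continuous fun y => ∑ l ∈ Finset.Icc (-(r : ℤ)) (p : ℤ), α l * U 0 (y + l * dx) :=
        continuous_finsetSum _ fun l _ =>
          continuous_const.mul (hU0.comp (continuous_id.add continuous_const))
      have hcont' : Continuous fun y => U 0 (y - lam * a * dx) :=
        hU0.comp (continuous_id.sub continuous_const)
      rw [hF, stencil_cellAverage hU0, ← cellAverage_sub hcont hcont']
      refine abs_cellAverage_le hdx fun y hy1 hy2 => ?_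
      refine (abs_consistency_le hα hq hU hdx.le hr hp hκ y).trans ?_
      refine mul_le_mul_of_nonneg_left (mul_le_mul_of_nonneg_left ?_ (by positivity)) hS0
      have hκ0 : 0 ≤ (κ : ℝ) * dx := by positivity
      refine intervalIntegral.integral_mono_interval ?_ (by linarith) ?_
        (Filter.Eventually.of_forall fun t => abs_nonneg _)
        (intervalIntegrable_of_locallyIntegrable hfl _ _).abs
      · push_cast
        linarith
      · push_cast
        linarith
    have h2 : X ^ 2 ≤ (2 * κ + 1) * dx * ∑ i ∈ Finset.range (2 * κ + 1), c (J + κ - i) := by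
      have h3 := sq_integral_le hle (intervalIntegrable_of_locallyIntegrable hfl _ _).abs
        (by simp only [sq_abs]; exact hf.intervalIntegrable)
      rw [sum_integral_cells hf]
      simp only [sq_abs] at h3
      refine h3.trans_eq ?_
      push_cast
      ring
    calc (F j) ^ 2 = |F j| ^ 2 := (sq_abs _).symm
      _ ≤ (S * ((κ * dx) ^ q * X)) ^ 2 := pow_le_pow_left₀ (abs_nonneg _) h1 2
      _ = S ^ 2 * ((κ * dx) ^ q) ^ 2 * X ^ 2 := by ring
      _ ≤ S ^ 2 * ((κ * dx) ^ q) ^ 2 *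
          ((2 * κ + 1) * dx * ∑ i ∈ Finset.range (2 * κ + 1), c (J + κ - i)) :=
        mul_le_mul_of_nonneg_left h2 (by positivity)
      _ = D * ∑ i ∈ Finset.range (2 * κ + 1), c (J + κ - i) := by
        rw [hD]
        ring
  have hsum : ∀ n, ∑ i ∈ Finset.range n, (F (-(i : ℤ))) ^ 2 ≤
      D * ((2 * κ + 1) * ∫ x, (f x) ^ 2) := by
    intro n
    refine (Finset.sum_le_sum fun (i : ℕ) _ => hpt (-(i : ℤ))).trans ?_
    rw [← Finset.mul_sum, Finset.sum_comm]
    refine mul_le_mul_of_nonneg_left ?_ hD0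
    -- For a fixed offset `i'` the cells are disjoint, so the sum is at most the full integral;
    -- there are `2 κ + 1` offsets.
    have h3 := Finset.sum_le_card_nsmul (Finset.range (2 * κ + 1))
      (fun i' => ∑ i ∈ Finset.range n, c (j₀ + -(i : ℤ) + κ - i')) (∫ x, (f x) ^ 2)
      fun i' _ => by
        have e : ∀ i : ℕ, j₀ + -(i : ℤ) + κ - i' = j₀ + κ - i' - i := fun i => by ring
        simp only [e]
        exact hcells _ n
    rw [Finset.card_range, nsmul_eq_mul] at h3
    exact_mod_cast h3
  refine ⟨summable_of_sum_range_le (fun _ => sq_nonneg _) hsum, ?_⟩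
  refine (Real.tsum_le_of_sum_range_le (fun _ => sq_nonneg _) hsum).trans_eq ?_
  rw [hD]
  ring

/-! ### Error estimate -/

theorem locallyIntegrable_comp_sub_right {f : ℝ → ℝ} (hf : LocallyIntegrable f) (s : ℝ) :
    LocallyIntegrable fun x => f (x - s) := by
  refine (locallyIntegrable_map_homeomorph (Homeomorph.subRight s)).1 ?_
  have : Measure.map (Homeomorph.subRight s) (volume : Measure ℝ) = volume :=
    (measurePreserving_sub_right volume s).map_eq
  rwa [this]

theorem IsDerivChain.translate {q : ℕ} {U : ℕ → ℝ → ℝ} {f : ℝ → ℝ} (h : IsDerivChain q U f)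
    (s : ℝ) : IsDerivChain q (fun m x => U m (x - s)) fun x => f (x - s) where
  continuous m hm := (h.continuous m hm).comp (continuous_id.sub continuous_const)
  hasDerivAt m hm x := (h.hasDerivAt m hm (x - s)).comp_sub_const x s
  locallyIntegrable := locallyIntegrable_comp_sub_right h.locallyIntegrable s
  sub_eq x y := by rw [h.sub_eq, intervalIntegral.integral_comp_sub_right]

theorem iterate_Dminus_shift_sub (n : ℕ) (v w : ℤ → ℝ) (J : ℤ) : ∀ j,
    Dminus^[n] (fun j => v (J + j) - w (J + j)) j =
      Dminus^[n] v (J + j) - Dminus^[n] w (J + j) := by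
  induction n with
  | zero => intro j; rfl
  | succ n ih =>
    intro j
    rw [Function.iterate_succ_apply', Function.iterate_succ_apply', Function.iterate_succ_apply',
      Dminus, ih, ih, Dminus, Dminus, show J + (j - 1) = J + j - 1 by ring]
    ring

theorem stencil_shift_sub {r p : ℕ} {α : ℤ → ℝ} (v w : ℤ → ℝ) (J j : ℤ) :
    stencil r p α (fun j => v (J + j) - w (J + j)) j =
      stencil r p α v (J + j) - stencil r p α w (J + j) := by
  simp only [stencil, ← Finset.sum_sub_distrib, ← mul_sub, add_assoc]

/-- Only `q` of the `n` differences can be turned into derivatives; each of the others costs a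
factor `2`. -/
theorem abs_iterate_Dminus_cellAverage_le {q n : ℕ} (hqn : q ≤ n) {U : ℕ → ℝ → ℝ} {f : ℝ → ℝ}
    (hU : IsDerivChain q U f) {B dx : ℝ} (hdx : 0 < dx) (hB : ∀ x, |U q x| ≤ B) (j : ℤ) :
    |Dminus^[n] (cellAverage dx (U 0)) j| ≤ 2 ^ (n - q) * (dx ^ q * B) := by
  rw [iterate_Dminus_cellAverage n (hU.continuous 0 (Nat.zero_le q))]
  refine abs_cellAverage_le hdx fun y _ _ => ?_
  have h : (backDiff dx)^[n] (U 0) = (backDiff dx)^[n - q] ((backDiff dx)^[q] (U 0)) := by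
    rw [← Function.iterate_add_apply, Nat.sub_add_cancel hqn]
  rw [h]
  exact abs_iterate_backDiff_le_of_bounded
    (abs_iterate_backDiff_le q hdx.le hU.hasDerivAt hB) dx (n - q) y

/-- Since `s ≥ 0`, the shifted cell stays to the left of `L`: the characteristics leave through the
boundary, so the extension does not affect the exact solution on the cells `j ≤ J`. -/
theorem cellAverage_congr_of_ae {L dx s : ℝ} {g h : ℝ → ℝ} (hdx : 0 < dx) (hs : 0 ≤ s)
    (hgh : ∀ᵐ x, x ∈ Set.Iio L → g x = h x) {j : ℤ} (hj : (j : ℝ) * dx ≤ L) :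
    cellAverage dx (fun y => g (y - s)) j = cellAverage dx (fun y => h (y - s)) j := by
  rw [cellAverage, cellAverage, intervalIntegral.integral_comp_sub_right,
    intervalIntegral.integral_comp_sub_right]
  congr 1
  refine intervalIntegral.integral_congr_ae ?_
  filter_upwards [hgh, compl_mem_ae_iff.2 (measure_singleton L)] with x hx hxL hmem
  rw [Set.uIoc_of_le (by linarith)] at hmem
  exact hx (lt_of_le_of_ne (by linarith [hmem.2]) hxL)

/-- The cells on the left of the boundary, numbered from the boundary. -/
def cellEquiv (J : ℤ) : ℕ ≃ Set.Iic J where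
  toFun i := ⟨J + -(i : ℤ), by rw [Set.mem_Iic]; omega⟩
  invFun j := (J - j).toNat
  left_inv i := by simp
  right_inv j := by
    have := j.2
    rw [Set.mem_Iic] at this
    ext
    push_cast
    omega

/-- The `ℓ²` error estimate, squared, with the boundary at the cell `0`. -/
theorem exists_error_estimate {a lam : ℝ} {k r p : ℕ} {α : ℤ → ℝ} (ha : 0 < a) (hlam : 0 < lam)
    (hk : 1 ≤ k) (hp : 1 ≤ p) (hα : SchemeAssumption a lam k r p α) (kb : ℕ) :
    ∃ C : ℝ, 0 < C ∧ ∀ (T : ℝ) (J : ℕ) (L dx dt : ℝ), 0 < T → 0 < dx → (J : ℝ) * dx = L →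
      dt = lam * dx → ∀ u₀ : ℝ → ℝ, MemH (min k kb + 1) (Set.Iio L) u₀ →
      ∀ u : ℕ → ℤ → ℝ, IsSolution r p α kb J dx dt T u₀ u → ∀ n : ℕ, (n : ℝ) ≤ T / dt →
        FiniteEnergy (fun j => schemeError a dx dt u₀ u n (J + j)) ∧
        dx * energy (fun j => schemeError a dx dt u₀ u n (J + j)) ≤
          (C * (Real.sqrt T + T) * dx ^ (min k kb) * normH (min k kb + 1) (Set.Iio L) u₀) ^ 2 := by
  obtain ⟨Cs, hCs, hstab⟩ := exists_stability ha hlam hk hp hα kb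
  set q := min k kb with hq
  obtain ⟨κ, hκr, hκp, hκ⟩ : ∃ κ : ℕ, r ≤ κ ∧ p ≤ κ ∧ |lam * a| ≤ κ := by
    obtain ⟨m, hm⟩ := exists_nat_ge |lam * a|
    exact ⟨r + p + m, by omega, by omega, hm.trans (by exact_mod_cast Nat.le_add_left m (r + p))⟩
  set K₁ := ((∑ l ∈ Finset.Icc (-(r : ℤ)) (p : ℤ), |α l|) + 1) ^ 2 * (κ : ℝ) ^ (2 * q) *
    (2 * κ + 1) ^ 2 with hK₁
  have hK₁0 : 0 ≤ K₁ := by positivity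
  set K₂ : ℝ := p * (2 ^ (kb - q) * 2) ^ 2 with hK₂
  have hK₂0 : 0 ≤ K₂ := by positivity
  set C₀ := Cs * (K₁ / lam ^ 2 + K₂ / lam) with hC₀
  have hC₀0 : 0 ≤ C₀ := by positivity
  refine ⟨Real.sqrt C₀ + 1, by positivity,
    fun T J L dx dt hT hdx hJ hdt u₀ hu₀ u hu n hn => ?_⟩
  have hdt0 : 0 < dt := hdt ▸ mul_pos hlam hdx
  obtain ⟨U, f, hU, hUu, hf, hfX, hUX⟩ := exists_extension hu₀
  set X := normH (q + 1) (Set.Iio L) u₀ with hX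
  have hX0 : 0 ≤ X := Real.sqrt_nonneg _
  -- Built from the extension, `W` also makes sense in the ghost cells, where the boundary condition
  -- and the stencil need it.
  set W : ℕ → ℤ → ℝ := fun n => cellAverage dx fun y => U 0 (y - a * ((n : ℝ) * dt)) with hW
  set e : ℕ → ℤ → ℝ := fun n j => u n (J + j) - W n (J + j) with he
  set F : ℕ → ℤ → ℝ := fun n j => stencil r p α (W n) (J + j) - W (n + 1) (J + j) with hF
  set N := ⌊T / dt⌋₊ with hN
  have hNT : (N : ℝ) ≤ T / dt := Nat.floor_le (by positivity)
  have hlt : ∀ m < N, (m : ℝ) ≤ T / dt - 1 := fun m hm => by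
    have : ((m + 1 : ℕ) : ℝ) ≤ N := by exact_mod_cast hm
    push_cast at this
    linarith
  have herr : ∀ n : ℕ, ∀ j ≤ 0, e n j = schemeError a dx dt u₀ u n (J + j) := by
    intro n j hj
    simp only [he, hW, schemeError]
    rw [cellAverage_congr_of_ae hdx (by positivity) hUu]
    rw [← hJ]
    refine mul_le_mul_of_nonneg_right ?_ hdx.le
    have : (J : ℤ) + j ≤ J := by omega
    exact_mod_cast this
  have h0 : ∀ j ≤ 0, e 0 j = 0 := by
    intro j hj
    rw [herr 0 j hj, schemeError, hu.init _ (by omega)]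
    simp
  have hrec : ∀ m < N, ∀ j ≤ 0, e (m + 1) j = stencil r p α (e m) j + F m j := by
    intro m hm j hj
    simp only [he, hF]
    rw [hu.interior m (hlt m hm) _ (by omega), stencil_shift_sub]
    ring
  have hFe : ∀ m < N, FiniteEnergy (F m) ∧ energy (F m) ≤ K₁ * dx ^ (2 * q + 1) * X ^ 2 := by
    intro m _
    have hf' : Integrable fun x => (f (x - a * ((m : ℝ) * dt))) ^ 2 :=
      hf.comp_sub_right (a * ((m : ℝ) * dt))
    obtain ⟨h1, h2⟩ := energy_consistency_le hα (min_le_left k kb) (hU.translate (a * ((m : ℝ) * dt)))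
      hf' hdx hκr hκp hκ J (F := F m) fun j => by
        simp only [hF, hW]
        congr 3
        funext y
        congr 1
        rw [hdt]
        push_cast
        ring
    refine ⟨h1, h2.trans ?_⟩
    rw [integral_sub_right_eq_self (fun x => (f x) ^ 2) (a * ((m : ℝ) * dt))]
    exact mul_le_mul_of_nonneg_left hfX (by positivity)
  -- The numerical solution satisfies the homogeneous condition, so the boundary data of `e` are
  -- those of `-W`, of size `dx ^ q`.
  have hbd : ∀ m < N, ∑ i ∈ Finset.range p, (Dminus^[kb] (e m) ((i : ℤ) + 1)) ^ 2 ≤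
      K₂ * (dx ^ q * X) ^ 2 := by
    intro m hm
    have h1 : ∀ i ∈ Finset.range p, (Dminus^[kb] (e m) ((i : ℤ) + 1)) ^ 2 ≤
        (2 ^ (kb - q) * (dx ^ q * (2 * X))) ^ 2 := by
      intro i hi
      have hi' := Finset.mem_range.1 hi
      have h2 := hu.boundary m (hlt m hm) (i + 1) (Finset.mem_Icc.2 ⟨by omega, by omega⟩)
      rw [he, iterate_Dminus_shift_sub kb (u m) (W m), ← Nat.cast_succ, h2, zero_sub, neg_sq,
        ← sq_abs]
      exact pow_le_pow_left₀ (abs_nonneg _) (abs_iterate_Dminus_cellAverage_le (min_le_right k kb)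
        (hU.translate (a * ((m : ℝ) * dt))) hdx (fun x => hUX _) _) 2
    refine (Finset.sum_le_card_nsmul _ _ _ h1).trans_eq ?_
    rw [Finset.card_range, nsmul_eq_mul, hK₂]
    ring
  have hnN : n ≤ N := Nat.le_floor hn
  obtain ⟨h1, h2⟩ := hstab N e F (K₁ * dx ^ (2 * q + 1) * X ^ 2) (K₂ * (dx ^ q * X) ^ 2)
    (by positivity) (by positivity) h0 hrec hFe hbd n hnN
  refine ⟨h1.congr (herr n), ?_⟩
  rw [← energy_congr (herr n)]
  have htr : 0 ≤ ∑ m ∈ Finset.range n, boundaryTrace r p (e m) :=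
    Finset.sum_nonneg fun _ _ => boundaryTrace_nonneg _ _ _
  have hNdx : (N : ℝ) * dx ≤ T / lam := by
    rw [le_div_iff₀ hdt0, hdt] at hNT
    rw [le_div_iff₀ hlam]
    linarith
  have hNdx2 : ((N : ℝ) * dx) ^ 2 ≤ (T / lam) ^ 2 := pow_le_pow_left₀ (by positivity) hNdx 2
  have hsq : T ^ 2 ≤ (Real.sqrt T + T) ^ 2 :=
    pow_le_pow_left₀ hT.le (by linarith [Real.sqrt_nonneg T]) 2
  have hsq' : T ≤ (Real.sqrt T + T) ^ 2 := by
    calc T = Real.sqrt T ^ 2 := (Real.sq_sqrt hT.le).symm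
      _ ≤ (Real.sqrt T + T) ^ 2 := pow_le_pow_left₀ (Real.sqrt_nonneg T) (by linarith) 2
  have hCle : C₀ ≤ (Real.sqrt C₀ + 1) ^ 2 := by
    calc C₀ = Real.sqrt C₀ ^ 2 := (Real.sq_sqrt hC₀0).symm
      _ ≤ (Real.sqrt C₀ + 1) ^ 2 := pow_le_pow_left₀ (Real.sqrt_nonneg _) (by linarith) 2
  calc dx * energy (e n)
      ≤ dx * (Cs * (N ^ 2 * (K₁ * dx ^ (2 * q + 1) * X ^ 2) + N * (K₂ * (dx ^ q * X) ^ 2))) :=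
        mul_le_mul_of_nonneg_left (by linarith) hdx.le
    -- The interior forcing contributes `(N dx)²`, hence `T` after the square root; the boundary
    -- data contribute `N dx`, hence `√T`.
    _ = Cs * (K₁ * (N * dx) ^ 2 + K₂ * (N * dx)) * (dx ^ q * X) ^ 2 := by ring
    _ ≤ Cs * (K₁ * (T / lam) ^ 2 + K₂ * (T / lam)) * (dx ^ q * X) ^ 2 := by gcongr
    _ = Cs * (K₁ / lam ^ 2 * T ^ 2 + K₂ / lam * T) * (dx ^ q * X) ^ 2 := by ring
    _ ≤ Cs * (K₁ / lam ^ 2 * (Real.sqrt T + T) ^ 2 + K₂ / lam * (Real.sqrt T + T) ^ 2) *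
          (dx ^ q * X) ^ 2 := by gcongr
    _ = C₀ * ((Real.sqrt T + T) ^ 2 * (dx ^ q * X) ^ 2) := by rw [hC₀]; ring
    _ ≤ (Real.sqrt C₀ + 1) ^ 2 * ((Real.sqrt T + T) ^ 2 * (dx ^ q * X) ^ 2) := by gcongr
    _ = ((Real.sqrt C₀ + 1) * (Real.sqrt T + T) * dx ^ q * X) ^ 2 := by ring

theorem MemH.mono {m m' : ℕ} (h : m ≤ m') {O : Set ℝ} {u : ℝ → ℝ} (hu : MemH m' O u) :
    MemH m O u :=
  ⟨hu.1, fun i hi => hu.2 i (hi.trans h)⟩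

end NeumannScheme

theorem theorem3 (a : ℝ) (ha : 0 < a) (k : ℕ) (hk : 1 ≤ k) (kb : ℕ) (lam : ℝ) (hlam : 0 < lam)
    (r p : ℕ) (hp : 1 ≤ p) (α : ℤ → ℝ) (hα : SchemeAssumption a lam k r p α) :
    ∃ C : ℝ, 0 < C ∧
      ∀ (T : ℝ) (J : ℕ) (L : ℝ) (dx dt : ℝ), 0 < T → 1 ≤ J → 1 ≤ L →
        dx = L / (J : ℝ) → dt = lam * dx → dt ≤ 1 →
        ∀ u₀ : ℝ → ℝ, MemH (k + 1) (Set.Iio L) u₀ →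
        ∀ u : ℕ → ℤ → ℝ, IsSolution r p α kb J dx dt T u₀ u →
          ∀ n : ℕ, (n : ℝ) ≤ T / dt →
            (Summable (fun j : Set.Iic (J : ℤ) => dx * (schemeError a dx dt u₀ u n j) ^ 2) ∧
              Real.sqrt (∑' j : Set.Iic (J : ℤ), dx * (schemeError a dx dt u₀ u n j) ^ 2) ≤
                C * (Real.sqrt T + T) * dx ^ (min k kb) *
                  normH (min k kb + 1) (Set.Iio L) u₀) ∧
            (∀ j : ℤ, j ≤ (J : ℤ) →
              |schemeError a dx dt u₀ u n j| ≤
                C * (Real.sqrt T + T) * dx ^ (((min k kb : ℕ) : ℝ) - 1 / 2) *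
                  normH (min k kb + 1) (Set.Iio L) u₀) := by
  obtain ⟨C, hC, hest⟩ := exists_error_estimate ha hlam hk hp hα kb
  refine ⟨C, hC, fun T J L dx dt hT hJ hL hdx hdt _ u₀ hu₀ u hu n hn => ?_⟩
  have hJ0 : (0 : ℝ) < J := by exact_mod_cast hJ
  have hdx0 : 0 < dx := by rw [hdx]; positivity
  obtain ⟨hfin, hle⟩ := hest T J L dx dt hT hdx0 (by rw [hdx]; field_simp) hdt u₀
    (hu₀.mono (by have := min_le_left k kb; omega)) u hu n hn
  set X := normH (min k kb + 1) (Set.Iio L) u₀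
  have hX0 : 0 ≤ X := Real.sqrt_nonneg _
  have hR0 : 0 ≤ C * (Real.sqrt T + T) * dx ^ (min k kb) * X := by positivity
  have hs : Summable fun i : ℕ => dx * (schemeError a dx dt u₀ u n (J + -(i : ℤ))) ^ 2 :=
    Summable.mul_left dx hfin
  have hs' : Summable fun j : Set.Iic (J : ℤ) => dx * (schemeError a dx dt u₀ u n j) ^ 2 :=
    (cellEquiv (J : ℤ)).summable_iff.1 hs
  have ht : ∑' j : Set.Iic (J : ℤ), dx * (schemeError a dx dt u₀ u n j) ^ 2 =
      dx * energy (fun j => schemeError a dx dt u₀ u n (J + j)) := by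
    rw [energy, ← tsum_mul_left, ← (cellEquiv (J : ℤ)).tsum_eq]
    rfl
  refine ⟨⟨hs', ?_⟩, fun j hj => ?_⟩
  · rw [ht]
    exact (Real.sqrt_le_left hR0).2 hle
  -- A single term of the `ℓ²` sum already bounds the pointwise error, at the cost of `dx ^ (-1/2)`.
  · have h1 : dx * (schemeError a dx dt u₀ u n j) ^ 2 ≤
        (C * (Real.sqrt T + T) * dx ^ (min k kb) * X) ^ 2 :=
      (hs'.le_tsum ⟨j, hj⟩ fun _ _ => by positivity).trans (ht.trans_le hle)
    have h2 : Real.sqrt dx * |schemeError a dx dt u₀ u n j| ≤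
        C * (Real.sqrt T + T) * dx ^ (min k kb) * X := by
      refine abs_le_of_sq_le_sq' ?_ hR0 |>.2
      rwa [mul_pow, Real.sq_sqrt hdx0.le, sq_abs]
    have h3 : dx ^ (((min k kb : ℕ) : ℝ) - 1 / 2) = dx ^ (min k kb) / Real.sqrt dx := by
      rw [Real.rpow_sub hdx0, Real.rpow_natCast, Real.sqrt_eq_rpow]
    rw [h3, ← mul_div_assoc, div_mul_eq_mul_div, le_div_iff₀ (Real.sqrt_pos.2 hdx0)]
    linarith
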